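/- **Theorem.** For a finite graph $Z$ (unoriented, without loops or multiple edges) with vertex set $V$ and adjacency matrix $d_Z$, let $A(Z)$ be the universal unital $C^*$-algebra generated by elements $u_{ij}$ ($i,j\in V$) subject to the relations that make $u=(u_{ij})$ a magic unitary matrix (all entries are projections, and every row and every column consists of pairwise orthogonal projections with sum $1$) and to the relation $d_Zu=ud_Z$. It is a Hopf $C^*$-algebra with $\Delta(u_{ij})=\sum_k u_{ik}\otimes u_{kj}$, $\varepsilon(u_{ij})=\delta_{ij}$ and $S(u_{ij})=u_{ji}$. Here $\otimes$ is the maximal tensor product of $C^*$-algebras, and a tensor product of Hopf $C^*$-algebras carries the tensor product structure. Let $X$ and $Y$ be finite connected regular graphs, and let $\{\lambda_i\}$ and $\{\mu_k\}$ be the sets of eigenvalues of $d_X$ and $d_Y$. Let $X\times Y$ (direct product) and $X\square Y$ (Cartesian product) be the graphs on the set of pairs of vertices, in which $(i,\alpha)\sim(j,\beta)$ means, respectively, $i\sim j$ and $\alpha\sim\beta$; and ($i=j$ and $\alpha\sim\beta$) or ($i\sim j$ and $\alpha=\beta$). 1. If $0\notin\{\lambda_i\}$, $0\notin\{\mu_k\}$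 and $\{\lambda_i/\lambda_j\}\cap\{\mu_k/\mu_l\}=\{1\}$, then $A(X\times Y)=A(X)\otimes A(Y)$. 2. If $\{\lambda_i-\lambda_j\}\cap\{\mu_k-\mu_l\}=\{0\}$, then $A(X\square Y)=A(X)\otimes A(Y)$. In both cases equality means that there is an isomorphism of Hopf $C^*$-algebras from the left-hand side to the right-hand side which maps the generator $u_{(i,\alpha),(j,\beta)}$ to $u_{ij}\otimes u_{\alpha\beta}$. -/

import Mathlib

open scoped TensorProduct

noncomputable section

namespace QuantumGraph

/-! ### C*-seminorms and universal C*-algebras -/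

/-- A C*-seminorm on a unital complex *-algebra: a submultiplicative seminorm `p` with
`p (x* x) = p (x) ^ 2`. -/
structure CStarSeminorm (R : Type*) [Ring R] [StarRing R] [Algebra ℂ R] extends
    Seminorm ℂ R where
  mul_le' : ∀ x y : R, toFun (x * y) ≤ toFun x * toFun y
  star_mul_self' : ∀ x : R, toFun (star x * x) = toFun x ^ 2

namespace CStarSeminorm

section basic

variable {R : Type*} [Ring R] [StarRing R] [Algebra ℂ R]

instance : FunLike (CStarSeminorm R) R ℝ where
  coe p := p.toFun
  coe_injective p q h := by
    obtain ⟨p, _, _⟩ := p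
    obtain ⟨q, _, _⟩ := q
    congr
    exact DFunLike.coe_injective h

instance : SeminormClass (CStarSeminorm R) ℂ R where
  map_zero p := map_zero p.toSeminorm
  map_add_le_add p := map_add_le_add p.toSeminorm
  map_neg_eq_map p := map_neg_eq_map p.toSeminorm
  map_smul_eq_mul p := map_smul_eq_mul p.toSeminorm

theorem map_mul_le (p : CStarSeminorm R) (x y : R) : p (x * y) ≤ p x * p y := p.mul_le' x y

theorem map_star_mul_self (p : CStarSeminorm R) (x : R) : p (star x * x) = p x ^ 2 :=
  p.star_mul_self' x

theorem map_star (p : CStarSeminorm R) (x : R) : p (star x) = p x := by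
  have key : ∀ y : R, p y ≤ p (star y) := by
    intro y
    have h := (p.map_star_mul_self y).symm.le.trans (p.map_mul_le (star y) y)
    rcases (apply_nonneg p y).eq_or_lt with h0 | h0
    · rw [← h0]; exact apply_nonneg p _
    · nlinarith
  exact le_antisymm (by simpa using key (star x)) (key x)

theorem map_one_le (p : CStarSeminorm R) : p 1 ≤ 1 := by
  have h := p.map_star_mul_self 1
  simp only [star_one, mul_one] at h
  nlinarith [apply_nonneg p (1 : R)]

/-- A *-homomorphism into a C*-algebra pulls the norm back to a C*-seminorm. -/
def ofHom {B : Type*} [CStarAlgebra B] (φ : R →⋆ₐ[ℂ] B) : CStarSeminorm R where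
  toFun x := ‖φ x‖
  map_zero' := by simp
  add_le' x y := by simpa using norm_add_le (φ x) (φ y)
  neg' x := by simp
  smul' c x := by simp [norm_smul]
  mul_le' x y := by simpa using norm_mul_le (φ x) (φ y)
  star_mul_self' x := by
    rw [map_mul, StarHomClass.map_star, CStarRing.norm_star_mul_self, sq]

theorem ofHom_apply {B : Type*} [CStarAlgebra B] (φ : R →⋆ₐ[ℂ] B) (x : R) :
    ofHom φ x = ‖φ x‖ := rfl

/-- Pull back a C*-seminorm along a *-homomorphism. -/
def comap {R' : Type*} [Ring R'] [StarRing R'] [Algebra ℂ R'] (p : CStarSeminorm R)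
    (φ : R' →⋆ₐ[ℂ] R) : CStarSeminorm R' where
  toFun x := p (φ x)
  map_zero' := by simp
  add_le' x y := by simpa using map_add_le_add p (φ x) (φ y)
  neg' x := by simp
  smul' c x := by simpa using map_smul_eq_mul p c (φ x)
  mul_le' x y := by simpa using p.map_mul_le (φ x) (φ y)
  star_mul_self' x := by
    rw [map_mul, StarHomClass.map_star, p.map_star_mul_self]

end basic

section completion

variable {R : Type*} [Ring R] [StarRing R] [Algebra ℂ R]

/-- The algebra `R`, regarded as a seminormed algebra for the C*-seminorm `p`. -/
def Pre (_p : CStarSeminorm R) : Type _ := R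

variable (p : CStarSeminorm R)

instance : Ring p.Pre := inferInstanceAs (Ring R)
instance : StarRing p.Pre := inferInstanceAs (StarRing R)
instance : Algebra ℂ p.Pre := inferInstanceAs (Algebra ℂ R)
instance [StarModule ℂ R] : StarModule ℂ p.Pre := inferInstanceAs (StarModule ℂ R)

/-- The identity map of `R` onto its seminormed copy. -/
def toPre : R ≃⋆ₐ[ℂ] p.Pre := StarAlgEquiv.refl ℂ R

instance : SeminormedRing p.Pre :=
  { (inferInstance : Ring p.Pre),
    AddGroupSeminorm.toSeminormedAddCommGroup p.toSeminorm.toAddGroupSeminorm with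
    norm_mul_le := p.mul_le' }

instance : NormedSpace ℂ p.Pre where
  norm_smul_le c x := (map_smul_eq_mul p c x).le

theorem norm_toPre (x : R) : ‖p.toPre x‖ = p x := rfl

theorem isometry_star_pre : Isometry (star : p.Pre → p.Pre) :=
  AddMonoidHomClass.isometry_of_norm (starAddEquiv : p.Pre ≃+ p.Pre) (fun x => p.map_star x)

/-- The Hausdorff completion of `R` for the C*-seminorm `p`. -/
def Compl : Type _ := UniformSpace.Completion p.Pre

instance : NormedRing p.Compl := inferInstanceAs (NormedRing (UniformSpace.Completion p.Pre))
instance : CompleteSpace p.Compl :=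
  inferInstanceAs (CompleteSpace (UniformSpace.Completion p.Pre))
instance : NormedAlgebra ℂ p.Compl where
  __ : Algebra ℂ p.Compl := inferInstanceAs (Algebra ℂ (UniformSpace.Completion p.Pre))
  norm_smul_le c x := norm_smul_le (β := UniformSpace.Completion p.Pre) c x

/-- The canonical map from `R` to its completion. -/
def ofFun (x : R) : p.Compl := ((p.toPre x : p.Pre) : UniformSpace.Completion p.Pre)

theorem denseRange_ofFun : DenseRange p.ofFun :=
  UniformSpace.Completion.denseRange_coe (α := p.Pre)

theorem norm_ofFun (x : R) : ‖p.ofFun x‖ = p x := UniformSpace.Completion.norm_coe (p.toPre x)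

theorem ofFun_mul (x y : R) : p.ofFun (x * y) = p.ofFun x * p.ofFun y :=
  UniformSpace.Completion.coe_mul (p.toPre x) (p.toPre y)

theorem ofFun_add (x y : R) : p.ofFun (x + y) = p.ofFun x + p.ofFun y :=
  UniformSpace.Completion.coe_add (p.toPre x) (p.toPre y)

theorem ofFun_smul (c : ℂ) (x : R) : p.ofFun (c • x) = c • p.ofFun x :=
  UniformSpace.Completion.coe_smul c (p.toPre x)

instance : Star p.Compl where
  star := UniformSpace.Completion.map (star : p.Pre → p.Pre)

theorem continuous_star_compl : Continuous (star : p.Compl → p.Compl) :=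
  UniformSpace.Completion.continuous_map

theorem ofFun_star (x : R) : p.ofFun (star x) = star (p.ofFun x) :=
  (UniformSpace.Completion.map_coe p.isometry_star_pre.uniformContinuous (p.toPre x)).symm

instance : StarRing p.Compl where
  star_involutive := by
    intro x
    refine p.denseRange_ofFun.induction_on (p := fun x => star (star x) = x) x ?_ ?_
    · exact isClosed_eq (p.continuous_star_compl.comp p.continuous_star_compl) continuous_id
    · intro x; simp [← ofFun_star]
  star_mul := by
    intro x y
    refine p.denseRange_ofFun.induction_on₂ (p := fun x y => star (x * y) = star y * star x)
      ?_ ?_ x y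
    · have := p.continuous_star_compl
      exact isClosed_eq (by fun_prop) (by fun_prop)
    · intro x y; simp [← ofFun_star, ← ofFun_mul]
  star_add := by
    intro x y
    refine p.denseRange_ofFun.induction_on₂ (p := fun x y => star (x + y) = star x + star y)
      ?_ ?_ x y
    · have := p.continuous_star_compl
      exact isClosed_eq (by fun_prop) (by fun_prop)
    · intro x y; simp [← ofFun_star, ← ofFun_add]

instance [StarModule ℂ R] : StarModule ℂ p.Compl where
  star_smul := by
    intro c x
    refine p.denseRange_ofFun.induction_on (p := fun x => star (c • x) = star c • star x) x ?_ ?_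
    · exact isClosed_eq (p.continuous_star_compl.comp (continuous_const_smul c))
        (p.continuous_star_compl.const_smul (star c))
    · intro x
      rw [← ofFun_smul, ← ofFun_star, ← ofFun_star, ← ofFun_smul, star_smul]

instance : CStarRing p.Compl where
  norm_mul_self_le := by
    intro x
    refine p.denseRange_ofFun.induction_on (p := fun x => ‖x‖ * ‖x‖ ≤ ‖star x * x‖) x ?_ ?_
    · have := p.continuous_star_compl
      exact isClosed_le (by fun_prop) (by fun_prop)
    · intro x
      rw [← ofFun_star, ← ofFun_mul, norm_ofFun, norm_ofFun, p.map_star_mul_self, sq]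

/-- The Hausdorff completion of a *-algebra for a C*-seminorm is a C*-algebra. -/
instance [StarModule ℂ R] : CStarAlgebra p.Compl where

/-- The canonical *-homomorphism from `R` to its completion. -/
def of : R →⋆ₐ[ℂ] p.Compl where
  toFun := p.ofFun
  map_one' := UniformSpace.Completion.coe_one p.Pre
  map_mul' := p.ofFun_mul
  map_zero' := UniformSpace.Completion.coe_zero
  map_add' := p.ofFun_add
  commutes' _ := rfl
  map_star' := p.ofFun_star

theorem norm_of (x : R) : ‖p.of x‖ = p x := p.norm_ofFun x

theorem denseRange_of : DenseRange p.of := p.denseRange_ofFun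

variable {B : Type*} [CStarAlgebra B]

theorem hom_ext [StarModule ℂ R] {φ ψ : p.Compl →⋆ₐ[ℂ] B} (h : ∀ x, φ (p.of x) = ψ (p.of x)) : φ = ψ := by
  refine DFunLike.coe_injective (p.denseRange_of.equalizer ?_ ?_ (funext h))
  · exact AddMonoidHomClass.continuous_of_bound φ 1
      (fun x => by simpa using NonUnitalStarAlgHom.norm_apply_le φ x)
  · exact AddMonoidHomClass.continuous_of_bound ψ 1
      (fun x => by simpa using NonUnitalStarAlgHom.norm_apply_le ψ x)

/-- The continuous extension of a map `R → B` to the completion. -/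
def liftFun (φ : R → B) : p.Compl → B :=
  UniformSpace.Completion.extension (fun x : p.Pre => φ (p.toPre.symm x))

theorem continuous_liftFun (φ : R → B) : Continuous (p.liftFun φ) :=
  UniformSpace.Completion.continuous_extension

theorem liftFun_of (φ : R →⋆ₐ[ℂ] B) (h : ∀ x, ‖φ x‖ ≤ p x) (x : R) :
    p.liftFun φ (p.of x) = φ x := by
  refine UniformSpace.Completion.extension_coe ?_ (p.toPre x)
  exact (AddMonoidHomClass.lipschitz_of_bound
    ((φ : R →+ B).comp (p.toPre.symm : p.Pre →+ R)) 1
    (fun x => by simpa using! h (p.toPre.symm x))).uniformContinuous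

/-- A *-homomorphism bounded by `p` extends to the completion. -/
def lift [StarModule ℂ R] (φ : R →⋆ₐ[ℂ] B) (h : ∀ x, ‖φ x‖ ≤ p x) : p.Compl →⋆ₐ[ℂ] B where
  toFun := p.liftFun φ
  map_one' := by rw [← map_one p.of, p.liftFun_of φ h, map_one]
  map_zero' := by rw [← map_zero p.of, p.liftFun_of φ h, map_zero]
  map_mul' x y := by
    refine p.denseRange_of.induction_on₂
      (p := fun x y => p.liftFun φ (x * y) = p.liftFun φ x * p.liftFun φ y) ?_ ?_ x y
    · have := p.continuous_liftFun φ
      exact isClosed_eq (by fun_prop) (by fun_prop)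
    · intro x y
      rw [← map_mul, p.liftFun_of φ h, p.liftFun_of φ h, p.liftFun_of φ h, map_mul]
  map_add' x y := by
    refine p.denseRange_of.induction_on₂
      (p := fun x y => p.liftFun φ (x + y) = p.liftFun φ x + p.liftFun φ y) ?_ ?_ x y
    · have := p.continuous_liftFun φ
      exact isClosed_eq (by fun_prop) (by fun_prop)
    · intro x y
      rw [← map_add, p.liftFun_of φ h, p.liftFun_of φ h, p.liftFun_of φ h, map_add]
  commutes' c := by
    have : algebraMap ℂ p.Compl c = p.of (algebraMap ℂ R c) := rfl
    simp only [this]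
    rw [p.liftFun_of φ h, AlgHomClass.commutes]
  map_star' x := by
    refine p.denseRange_of.induction_on
      (p := fun x => p.liftFun φ (star x) = star (p.liftFun φ x)) x ?_ ?_
    · have := p.continuous_liftFun φ
      exact isClosed_eq (this.comp p.continuous_star_compl) (by fun_prop)
    · intro x
      rw [← StarHomClass.map_star p.of, p.liftFun_of φ h, p.liftFun_of φ h,
        StarHomClass.map_star φ]

theorem lift_of [StarModule ℂ R] (φ : R →⋆ₐ[ℂ] B) (h : ∀ x, ‖φ x‖ ≤ p x) (x : R) : p.lift φ h (p.of x) = φ x :=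
  p.liftFun_of φ h x

end completion

/-- A C*-seminorm on a C*-algebra is dominated by the norm. -/
theorem le_norm {A : Type*} [CStarAlgebra A] (p : CStarSeminorm A) (x : A) : p x ≤ ‖x‖ := by
  rw [← p.norm_of]
  exact NonUnitalStarAlgHom.norm_apply_le p.of x

end CStarSeminorm

/-- `p` is admissible for the relations `x = 0`, `x ∈ rel`. -/
def Admissible {R : Type*} [Ring R] [StarRing R] [Algebra ℂ R] (rel : Set R)
    (p : CStarSeminorm R) : Prop := ∀ x ∈ rel, p x = 0

/-- The relations `x = 0`, `x ∈ rel`, are bounded: each element of `R` is uniformly bounded for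
all admissible C*-seminorms. This is the condition for a universal C*-algebra to exist. -/
def BoundedRel {R : Type*} [Ring R] [StarRing R] [Algebra ℂ R] (rel : Set R) : Prop :=
  ∀ x, ∃ C : ℝ, ∀ p : CStarSeminorm R, Admissible rel p → p x ≤ C

section universal

variable {R : Type*} [Ring R] [StarRing R] [Algebra ℂ R] {rel : Set R}

theorem admissible_zero (rel : Set R) : ∃ p : CStarSeminorm R, Admissible rel p :=
  ⟨{ toSeminorm := 0
     mul_le' := fun _ _ => (mul_zero (0 : ℝ)).ge
     star_mul_self' := fun _ => (zero_pow (M₀ := ℝ) two_ne_zero).symm }, fun _ _ => rfl⟩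

instance : Nonempty {p : CStarSeminorm R // Admissible rel p} :=
  let ⟨p, hp⟩ := admissible_zero rel; ⟨⟨p, hp⟩⟩

theorem BoundedRel.bddAbove (h : BoundedRel rel) (x : R) :
    BddAbove (Set.range fun p : {p : CStarSeminorm R // Admissible rel p} => p.1 x) := by
  obtain ⟨C, hC⟩ := h x
  exact ⟨C, by rintro _ ⟨p, rfl⟩; exact hC p.1 p.2⟩

/-- The largest admissible C*-seminorm: the supremum of all admissible ones. -/
def univSeminorm (rel : Set R) (h : BoundedRel rel) : CStarSeminorm R where
  toFun x := ⨆ p : {p : CStarSeminorm R // Admissible rel p}, p.1 x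
  map_zero' := by simp
  add_le' x y := ciSup_le fun p => (map_add_le_add p.1 x y).trans
    (add_le_add (le_ciSup (h.bddAbove x) p) (le_ciSup (h.bddAbove y) p))
  neg' x := by simp
  smul' c x := by simp_rw [map_smul_eq_mul]; rw [Real.mul_iSup_of_nonneg (norm_nonneg c)]
  mul_le' x y := ciSup_le fun p => (p.1.map_mul_le x y).trans
    (mul_le_mul (le_ciSup (h.bddAbove x) p) (le_ciSup (h.bddAbove y) p) (apply_nonneg _ _)
      (Real.iSup_nonneg fun _ => apply_nonneg _ _))
  star_mul_self' x := by
    have h0 : 0 ≤ ⨆ p : {p : CStarSeminorm R // Admissible rel p}, p.1 x :=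
      Real.iSup_nonneg fun _ => apply_nonneg _ _
    apply le_antisymm
    · refine ciSup_le fun p => ?_
      rw [p.1.map_star_mul_self]
      exact pow_le_pow_left₀ (apply_nonneg _ _) (le_ciSup (h.bddAbove x) p) 2
    · rw [← Real.le_sqrt h0]
      refine ciSup_le fun p => Real.le_sqrt_of_sq_le ?_
      rw [← p.1.map_star_mul_self]
      · exact le_ciSup (h.bddAbove (star x * x)) p
      · exact Real.iSup_nonneg fun _ => apply_nonneg _ _

theorem le_univSeminorm (h : BoundedRel rel) {p : CStarSeminorm R} (hp : Admissible rel p)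
    (x : R) : p x ≤ univSeminorm rel h x := le_ciSup (h.bddAbove x) ⟨p, hp⟩

theorem univSeminorm_rel (h : BoundedRel rel) : Admissible rel (univSeminorm rel h) := by
  intro x hx
  refine (iSup_congr fun p => p.2 x hx).trans ?_
  simp

variable [StarModule ℂ R]

/-- The universal C*-algebra generated by the unital *-algebra `R` subject to the relations
`x = 0` for `x ∈ rel`: the Hausdorff completion of `R` for the largest C*-seminorm that vanishes
on `rel`. -/
def UniversalCStar (rel : Set R) (h : BoundedRel rel) : Type _ := (univSeminorm rel h).Compl

namespace UniversalCStar

variable (h : BoundedRel rel)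

instance : CStarAlgebra (UniversalCStar rel h) :=
  inferInstanceAs (CStarAlgebra (univSeminorm rel h).Compl)

/-- The canonical *-homomorphism from `R`. -/
def of : R →⋆ₐ[ℂ] UniversalCStar rel h := (univSeminorm rel h).of

theorem denseRange_of : DenseRange (of h) := (univSeminorm rel h).denseRange_of

theorem of_rel {x : R} (hx : x ∈ rel) : of h x = 0 := by
  rw [← norm_eq_zero]
  exact ((univSeminorm rel h).norm_of x).trans (univSeminorm_rel h x hx)

variable {B : Type*} [CStarAlgebra B]

theorem hom_ext {φ ψ : UniversalCStar rel h →⋆ₐ[ℂ] B} (hφ : ∀ x, φ (of h x) = ψ (of h x)) :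
    φ = ψ := (univSeminorm rel h).hom_ext hφ

/-- The universal property: a *-homomorphism from `R` to a C*-algebra that kills `rel` factors
through the universal C*-algebra. -/
def lift (φ : R →⋆ₐ[ℂ] B) (hφ : ∀ x ∈ rel, φ x = 0) : UniversalCStar rel h →⋆ₐ[ℂ] B :=
  (univSeminorm rel h).lift φ fun x =>
    le_univSeminorm h (p := CStarSeminorm.ofHom φ)
      (fun y hy => by rw [CStarSeminorm.ofHom_apply, hφ y hy, norm_zero]) x

theorem lift_of (φ : R →⋆ₐ[ℂ] B) (hφ : ∀ x ∈ rel, φ x = 0) (x : R) :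
    lift h φ hφ (of h x) = φ x := (univSeminorm rel h).lift_of φ _ x

end UniversalCStar

end universal

/-! ### The maximal tensor product of C*-algebras -/

section tensor

variable (A B : Type*) [CStarAlgebra A] [CStarAlgebra B]

/-- `a ↦ a ⊗ 1`, into the algebraic tensor product. -/
def algInl : A →⋆ₐ[ℂ] A ⊗[ℂ] B where
  __ := (Algebra.TensorProduct.includeLeft : A →ₐ[ℂ] A ⊗[ℂ] B)
  map_star' a := by simp [TensorProduct.star_tmul]

/-- `b ↦ 1 ⊗ b`, into the algebraic tensor product. -/
def algInr : B →⋆ₐ[ℂ] A ⊗[ℂ] B where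
  __ := (Algebra.TensorProduct.includeRight : B →ₐ[ℂ] A ⊗[ℂ] B)
  map_star' a := by simp [TensorProduct.star_tmul]

theorem boundedRel_tensor : BoundedRel (∅ : Set (A ⊗[ℂ] B)) := by
  intro x
  induction x using TensorProduct.induction_on with
  | zero => exact ⟨0, fun p _ => (map_zero p).le⟩
  | tmul a b =>
    refine ⟨‖a‖ * ‖b‖, fun p _ => ?_⟩
    have h : a ⊗ₜ[ℂ] b = algInl A B a * algInr A B b := by
      change a ⊗ₜ[ℂ] b = (a ⊗ₜ[ℂ] 1) * (1 ⊗ₜ[ℂ] b)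
      simp
    rw [h]
    exact (p.map_mul_le _ _).trans (mul_le_mul ((p.comap (algInl A B)).le_norm a)
      ((p.comap (algInr A B)).le_norm b) (apply_nonneg _ _) (norm_nonneg _))
  | add x y hx hy =>
    obtain ⟨C, hC⟩ := hx
    obtain ⟨D, hD⟩ := hy
    exact ⟨C + D, fun p hp => (map_add_le_add p x y).trans (add_le_add (hC p hp) (hD p hp))⟩

/-- The maximal C*-tensor product: the completion of the algebraic tensor product for its largest
C*-seminorm. -/
def MaxTensor : Type _ := UniversalCStar (∅ : Set (A ⊗[ℂ] B)) (boundedRel_tensor A B)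

namespace MaxTensor

instance : CStarAlgebra (MaxTensor A B) :=
  inferInstanceAs (CStarAlgebra (UniversalCStar _ (boundedRel_tensor A B)))

variable {A B}

/-- The canonical map from the algebraic tensor product. -/
def of : A ⊗[ℂ] B →⋆ₐ[ℂ] MaxTensor A B := UniversalCStar.of (boundedRel_tensor A B)

theorem denseRange_of : DenseRange (of : A ⊗[ℂ] B →⋆ₐ[ℂ] MaxTensor A B) :=
  UniversalCStar.denseRange_of (boundedRel_tensor A B)

/-- The elementary tensor `a ⊗ b`. -/
def tmul (a : A) (b : B) : MaxTensor A B := of (a ⊗ₜ[ℂ] b)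

/-- `a ↦ a ⊗ 1`. -/
def inl : A →⋆ₐ[ℂ] MaxTensor A B := of.comp (algInl A B)

/-- `b ↦ 1 ⊗ b`. -/
def inr : B →⋆ₐ[ℂ] MaxTensor A B := of.comp (algInr A B)

theorem inl_apply (a : A) : (inl a : MaxTensor A B) = tmul a 1 := rfl

theorem inr_apply (b : B) : (inr b : MaxTensor A B) = tmul 1 b := rfl

theorem inl_mul_inr (a : A) (b : B) : inl a * inr b = tmul a b := by
  rw [inl_apply, inr_apply, tmul, tmul, tmul, ← map_mul]; simp

theorem commute_inl_inr (a : A) (b : B) : Commute (inl a : MaxTensor A B) (inr b) := by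
  rw [commute_iff_eq, inl_apply, inr_apply, tmul, tmul, ← map_mul, ← map_mul]; simp

variable {C : Type*} [CStarAlgebra C]

theorem hom_ext {φ ψ : MaxTensor A B →⋆ₐ[ℂ] C} (hl : ∀ a, φ (inl a) = ψ (inl a))
    (hr : ∀ b, φ (inr b) = ψ (inr b)) : φ = ψ := by
  refine UniversalCStar.hom_ext (boundedRel_tensor A B) fun x => ?_
  change φ (of x) = ψ (of x)
  induction x using TensorProduct.induction_on with
  | zero => simp
  | tmul a b =>
    change φ (tmul a b) = ψ (tmul a b)
    rw [← inl_mul_inr, map_mul, map_mul, hl, hr]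
  | add x y hx hy => rw [map_add, map_add, map_add, hx, hy]

/-- The *-homomorphism from the algebraic tensor product given by a commuting pair. -/
def algLift (f : A →⋆ₐ[ℂ] C) (g : B →⋆ₐ[ℂ] C) (h : ∀ a b, Commute (f a) (g b)) :
    A ⊗[ℂ] B →⋆ₐ[ℂ] C where
  __ := Algebra.TensorProduct.lift f.toAlgHom g.toAlgHom h
  map_star' x := by
    change Algebra.TensorProduct.lift f.toAlgHom g.toAlgHom h (star x) =
      star (Algebra.TensorProduct.lift f.toAlgHom g.toAlgHom h x)
    induction x using TensorProduct.induction_on with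
    | zero => simp
    | tmul a b =>
      rw [TensorProduct.star_tmul, Algebra.TensorProduct.lift_tmul,
        Algebra.TensorProduct.lift_tmul, star_mul]
      change f (star a) * g (star b) = star (g b) * star (f a)
      rw [h (star a) (star b), StarHomClass.map_star, StarHomClass.map_star]
    | add x y hx hy => rw [star_add, map_add, map_add, star_add, hx, hy]

theorem algLift_tmul (f : A →⋆ₐ[ℂ] C) (g : B →⋆ₐ[ℂ] C) (h : ∀ a b, Commute (f a) (g b))
    (a : A) (b : B) : algLift f g h (a ⊗ₜ b) = f a * g b :=
  Algebra.TensorProduct.lift_tmul f.toAlgHom g.toAlgHom h a b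

/-- The universal property: *-homomorphisms with commuting ranges extend to the maximal tensor
product. -/
def lift (f : A →⋆ₐ[ℂ] C) (g : B →⋆ₐ[ℂ] C) (h : ∀ a b, Commute (f a) (g b)) :
    MaxTensor A B →⋆ₐ[ℂ] C :=
  UniversalCStar.lift (boundedRel_tensor A B) (algLift f g h) (by simp)

theorem lift_tmul (f : A →⋆ₐ[ℂ] C) (g : B →⋆ₐ[ℂ] C) (h : ∀ a b, Commute (f a) (g b))
    (a : A) (b : B) : lift f g h (tmul a b) = f a * g b :=
  (UniversalCStar.lift_of (boundedRel_tensor A B) (algLift f g h) (by simp) _).trans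
    (algLift_tmul f g h a b)

theorem lift_inl (f : A →⋆ₐ[ℂ] C) (g : B →⋆ₐ[ℂ] C) (h : ∀ a b, Commute (f a) (g b))
    (a : A) : lift f g h (inl a) = f a := by
  rw [inl_apply, lift_tmul, map_one, mul_one]

theorem lift_inr (f : A →⋆ₐ[ℂ] C) (g : B →⋆ₐ[ℂ] C) (h : ∀ a b, Commute (f a) (g b))
    (b : B) : lift f g h (inr b) = g b := by
  rw [inr_apply, lift_tmul, map_one, one_mul]

variable {A' B' : Type*} [CStarAlgebra A'] [CStarAlgebra B']

/-- The tensor product `f ⊗ g` of two *-homomorphisms. -/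
def map (f : A →⋆ₐ[ℂ] A') (g : B →⋆ₐ[ℂ] B') : MaxTensor A B →⋆ₐ[ℂ] MaxTensor A' B' :=
  lift (inl.comp f) (inr.comp g) fun a b => commute_inl_inr (f a) (g b)

theorem map_tmul (f : A →⋆ₐ[ℂ] A') (g : B →⋆ₐ[ℂ] B') (a : A) (b : B) :
    map f g (tmul a b) = tmul (f a) (g b) :=
  (lift_tmul _ _ _ a b).trans (inl_mul_inr _ _)

theorem map_inl (f : A →⋆ₐ[ℂ] A') (g : B →⋆ₐ[ℂ] B') (a : A) : map f g (inl a) = inl (f a) :=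
  lift_inl _ _ _ a

theorem map_inr (f : A →⋆ₐ[ℂ] A') (g : B →⋆ₐ[ℂ] B') (b : B) : map f g (inr b) = inr (g b) :=
  lift_inr _ _ _ b

/-- If `c` commutes with `a ⊗ 1` and `1 ⊗ b` through `φ`, it commutes with all of the range. -/
theorem commute_range (φ : MaxTensor A B →⋆ₐ[ℂ] C) (c : C) (hl : ∀ a, Commute (φ (inl a)) c)
    (hr : ∀ b, Commute (φ (inr b)) c) (x : MaxTensor A B) : Commute (φ x) c := by
  have hφ : Continuous φ := AddMonoidHomClass.continuous_of_bound φ 1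
    (fun x => by simpa using NonUnitalStarAlgHom.norm_apply_le φ x)
  refine denseRange_of.induction_on (p := fun x => Commute (φ x) c) x ?_ ?_
  · exact isClosed_eq (by fun_prop) (by fun_prop)
  · intro x
    induction x using TensorProduct.induction_on with
    | zero => simp
    | tmul a b =>
      change Commute (φ (tmul a b)) c
      rw [← inl_mul_inr, map_mul]
      exact (hl a).mul_left (hr b)
    | add x y hx hy => rw [map_add, map_add]; exact hx.add_left hy

end MaxTensor

end tensor

/-! ### Structure maps of Hopf C*-algebras -/

section hopf

/-- A *-homomorphism, as a *-homomorphism of the opposite algebras. -/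
def opHom {A B : Type*} [CStarAlgebra A] [CStarAlgebra B] (f : A →⋆ₐ[ℂ] B) :
    Aᵐᵒᵖ →⋆ₐ[ℂ] Bᵐᵒᵖ where
  __ := AlgHom.op f.toAlgHom
  map_star' x := congrArg MulOpposite.op (StarHomClass.map_star f x.unop)

theorem opHom_apply {A B : Type*} [CStarAlgebra A] [CStarAlgebra B] (f : A →⋆ₐ[ℂ] B) (x : Aᵐᵒᵖ) :
    opHom f x = MulOpposite.op (f x.unop) := rfl

/-- The comultiplication, counit and antipode carried by a Hopf C*-algebra. Only the maps are
recorded; the ones used below are built explicitly. -/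
structure HopfMaps (A : Type*) [CStarAlgebra A] where
  comul : A →⋆ₐ[ℂ] MaxTensor A A
  counit : A →⋆ₐ[ℂ] ℂ
  antipode : A →⋆ₐ[ℂ] Aᵐᵒᵖ

variable {A B : Type*} [CStarAlgebra A] [CStarAlgebra B]

/-- Compatibility of a *-homomorphism with the comultiplications, counits and antipodes. -/
structure IsHopfHom (HA : HopfMaps A) (HB : HopfMaps B) (f : A →⋆ₐ[ℂ] B) : Prop where
  map_comul : ∀ a, HB.comul (f a) = MaxTensor.map f f (HA.comul a)
  map_counit : ∀ a, HB.counit (f a) = HA.counit a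
  map_antipode : ∀ a, HB.antipode (f a) = opHom f (HA.antipode a)

theorem commute_map_inl_map_inr (x : MaxTensor A A) (y : MaxTensor B B) :
    Commute (MaxTensor.map (MaxTensor.inl (B := B)) (MaxTensor.inl (B := B)) x)
      (MaxTensor.map (MaxTensor.inr (A := A)) (MaxTensor.inr (A := A)) y) := by
  have key : ∀ c : MaxTensor (MaxTensor A B) (MaxTensor A B),
      (∀ b, Commute (MaxTensor.inl (MaxTensor.inr b)) c) →
      (∀ b, Commute (MaxTensor.inr (MaxTensor.inr b)) c) →
      Commute c (MaxTensor.map MaxTensor.inr MaxTensor.inr y) := by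
    intro c h1 h2
    refine (MaxTensor.commute_range _ _ (fun b => ?_) (fun b => ?_) y).symm
    · rw [MaxTensor.map_inl]; exact h1 b
    · rw [MaxTensor.map_inr]; exact h2 b
  refine MaxTensor.commute_range _ _ (fun a => ?_) (fun a => ?_) x
  · rw [MaxTensor.map_inl]
    exact key _ (fun b => ((MaxTensor.commute_inl_inr a b).map MaxTensor.inl).symm)
      fun b => (MaxTensor.commute_inl_inr _ _).symm
  · rw [MaxTensor.map_inr]
    exact key _ (fun b => MaxTensor.commute_inl_inr _ _)
      fun b => ((MaxTensor.commute_inl_inr a b).map MaxTensor.inr).symm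

/-- The middle exchange `(a ⊗ a') ⊗ (b ⊗ b') ↦ (a ⊗ b) ⊗ (a' ⊗ b')`. -/
def middleSwap (A B : Type*) [CStarAlgebra A] [CStarAlgebra B] :
    MaxTensor (MaxTensor A A) (MaxTensor B B) →⋆ₐ[ℂ]
      MaxTensor (MaxTensor A B) (MaxTensor A B) :=
  MaxTensor.lift (MaxTensor.map MaxTensor.inl MaxTensor.inl)
    (MaxTensor.map MaxTensor.inr MaxTensor.inr) commute_map_inl_map_inr

theorem middleSwap_tmul (a a' : A) (b b' : B) :
    middleSwap A B (MaxTensor.tmul (MaxTensor.tmul a a') (MaxTensor.tmul b b')) =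
      MaxTensor.tmul (MaxTensor.tmul a b) (MaxTensor.tmul a' b') := by
  rw [middleSwap, MaxTensor.lift_tmul, MaxTensor.map_tmul, MaxTensor.map_tmul,
    ← MaxTensor.inl_mul_inr (MaxTensor.inl a), ← MaxTensor.inl_mul_inr (MaxTensor.inr b),
    ← MaxTensor.inl_mul_inr (MaxTensor.tmul a b), ← MaxTensor.inl_mul_inr a b,
    ← MaxTensor.inl_mul_inr a' b', map_mul, map_mul, mul_assoc, mul_assoc,
    ← mul_assoc (MaxTensor.inr _), ← mul_assoc (MaxTensor.inl (MaxTensor.inr b)),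
    (MaxTensor.commute_inl_inr (MaxTensor.inr b) (MaxTensor.inl a')).eq]

/-- The tensor product of Hopf C*-algebras:
`Δ = (id ⊗ σ ⊗ id) (Δ ⊗ Δ)`, `ε = ε ⊗ ε`, `S = S ⊗ S`. -/
def HopfMaps.tensor (HA : HopfMaps A) (HB : HopfMaps B) : HopfMaps (MaxTensor A B) where
  comul := (middleSwap A B).comp (MaxTensor.map HA.comul HB.comul)
  counit := MaxTensor.lift HA.counit HB.counit fun _ _ => Commute.all _ _
  antipode := MaxTensor.lift ((opHom MaxTensor.inl).comp HA.antipode)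
    ((opHom MaxTensor.inr).comp HB.antipode)
    fun _ _ => (MaxTensor.commute_inl_inr _ _).op

end hopf

/-! ### Free *-algebras -/

section free

/-- The free unital complex *-algebra on self-adjoint generators indexed by `S`: the
complexification of the free real algebra, where `*` reverses words and conjugates scalars. -/
def FreeStar (S : Type*) : Type _ := ℂ ⊗[ℝ] FreeAlgebra ℝ S

instance (S : Type*) : StarModule ℝ (FreeAlgebra ℝ S) where
  star_smul r x := by simp [Algebra.smul_def, Algebra.commutes]

namespace FreeStar

variable {S : Type*}

instance : Ring (FreeStar S) := inferInstanceAs (Ring (ℂ ⊗[ℝ] FreeAlgebra ℝ S))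
instance : StarRing (FreeStar S) := inferInstanceAs (StarRing (ℂ ⊗[ℝ] FreeAlgebra ℝ S))
instance : Algebra ℂ (FreeStar S) := inferInstanceAs (Algebra ℂ (ℂ ⊗[ℝ] FreeAlgebra ℝ S))

/-- A scalar times a real noncommutative polynomial. -/
def mk (z : ℂ) (w : FreeAlgebra ℝ S) : FreeStar S := z ⊗ₜ[ℝ] w

/-- The generators. -/
def gen (s : S) : FreeStar S := mk 1 (FreeAlgebra.ι ℝ s)

theorem star_mk (z : ℂ) (w : FreeAlgebra ℝ S) : star (mk z w) = mk (star z) (star w) :=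
  TensorProduct.star_tmul z w

theorem mk_mul_mk (z z' : ℂ) (w w' : FreeAlgebra ℝ S) : mk z w * mk z' w' = mk (z * z') (w * w') :=
  Algebra.TensorProduct.tmul_mul_tmul z z' w w'

theorem smul_mk (c z : ℂ) (w : FreeAlgebra ℝ S) : c • mk z w = mk (c * z) w :=
  TensorProduct.smul_tmul' c z w

theorem mk_add (z : ℂ) (w w' : FreeAlgebra ℝ S) : mk z (w + w') = mk z w + mk z w' :=
  TensorProduct.tmul_add z w w'

theorem one_def : (1 : FreeStar S) = mk 1 1 := rfl

theorem mk_algebraMap (r : ℝ) : mk 1 (algebraMap ℝ (FreeAlgebra ℝ S) r) = mk (r : ℂ) 1 := by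
  rw [mk, mk, Algebra.algebraMap_eq_smul_one, ← TensorProduct.smul_tmul, Complex.real_smul,
    mul_one]

theorem star_gen (s : S) : star (gen s) = gen s := by
  rw [gen, star_mk, star_one, FreeAlgebra.star_ι]

theorem add_induction {P : FreeStar S → Prop} (h0 : P 0) (hmk : ∀ z w, P (mk z w))
    (hadd : ∀ x y, P x → P y → P (x + y)) (x : FreeStar S) : P x :=
  TensorProduct.induction_on x h0 hmk hadd

/-- To prove a property of the elements of the free *-algebra, prove it for the generators and for
`1`, and its stability under sums, products and scalar multiples. -/
theorem induction {P : FreeStar S → Prop} (hone : P 1) (hgen : ∀ s, P (gen s))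
    (hadd : ∀ x y, P x → P y → P (x + y)) (hmul : ∀ x y, P x → P y → P (x * y))
    (hsmul : ∀ (c : ℂ) x, P x → P (c • x)) (x : FreeStar S) : P x := by
  have h1 : ∀ w : FreeAlgebra ℝ S, P (mk 1 w) := by
    intro w
    induction w with
    | grade0 r =>
      rw [mk_algebraMap]
      have h := hsmul r 1 hone
      rwa [one_def, smul_mk, mul_one] at h
    | grade1 s => exact hgen s
    | mul a b ha hb =>
      have h := hmul _ _ ha hb
      rwa [mk_mul_mk, mul_one] at h
    | add a b ha hb => rw [mk_add]; exact hadd _ _ ha hb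
  refine add_induction ?_ ?_ hadd x
  · simpa using hsmul 0 1 hone
  · intro z w
    have h := hsmul z _ (h1 w)
    rwa [smul_mk, mul_one] at h

instance : StarModule ℂ (FreeStar S) where
  star_smul c x := by
    refine add_induction (P := fun x => star (c • x) = star c • star x) (by simp) (fun z w => ?_) (fun x y hx hy => ?_) x
    · rw [smul_mk, star_mk, star_mk, smul_mk, star_mul']
    · rw [smul_add, star_add, hx, hy, star_add, smul_add]

variable {B : Type*} [CStarAlgebra B]

theorem hom_ext {φ ψ : FreeStar S →⋆ₐ[ℂ] B} (h : ∀ s, φ (gen s) = ψ (gen s)) : φ = ψ := by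
  refine DFunLike.ext _ _ fun x => ?_
  refine induction (P := fun x => φ x = ψ x) ?_ h ?_ ?_ ?_ x
  · rw [map_one, map_one]
  · intro x y hx hy; rw [map_add, map_add, hx, hy]
  · intro x y hx hy; rw [map_mul, map_mul, hx, hy]
  · intro c x hx; rw [map_smul, map_smul, hx]

/-- The algebra homomorphism with prescribed values on the generators. -/
def algLift (f : S → B) : FreeStar S →ₐ[ℂ] B :=
  Algebra.TensorProduct.lift (Algebra.ofId ℂ B) (FreeAlgebra.lift ℝ f)
    fun z _ => Algebra.commutes z _

theorem algLift_gen (f : S → B) (s : S) : algLift f (gen s) = f s := by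
  refine (Algebra.TensorProduct.lift_tmul _ _ _ _ _).trans ?_
  simp

/-- The universal property: any family of self-adjoint elements defines a *-homomorphism. -/
def lift (f : S → B) (hf : ∀ s, star (f s) = f s) : FreeStar S →⋆ₐ[ℂ] B where
  __ := algLift f
  map_star' x := by
    change algLift f (star x) = star (algLift f x)
    refine induction (P := fun x => algLift f (star x) = star (algLift f x)) ?_ ?_ ?_ ?_ ?_ x
    · rw [star_one, map_one, star_one]
    · intro s; rw [star_gen, algLift_gen, hf]
    · intro x y hx hy; rw [star_add, map_add, map_add, star_add, hx, hy]
    · intro x y hx hy; rw [star_mul, map_mul, map_mul, star_mul, hx, hy]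
    · intro c x hx; rw [star_smul, map_smul, map_smul, star_smul, hx]

theorem lift_gen (f : S → B) (hf : ∀ s, star (f s) = f s) (s : S) : lift f hf (gen s) = f s :=
  algLift_gen f s

end FreeStar

end free

/-! ### Magic unitaries and the quantum automorphism group of a graph -/

section magic

theorem adjMatrix_map {V : Type*} (G : SimpleGraph V) [DecidableRel G.Adj] {R R' : Type*} [Ring R]
    [Ring R'] (f : R →+* R') : (G.adjMatrix R).map f = G.adjMatrix R' := by
  ext i j
  by_cases h : G.Adj i j <;> simp [h]

variable {V : Type*} [Fintype V]

/-- A magic unitary matrix: the entries are projections, and each row and each column is a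
partition of unity (pairwise orthogonal projections with sum `1`). -/
structure IsMagicUnitary {A : Type*} [Ring A] [StarRing A] (u : Matrix V V A) : Prop where
  isStarProjection : ∀ i j, IsStarProjection (u i j)
  row_orthogonal : ∀ i j k, j ≠ k → u i j * u i k = 0
  col_orthogonal : ∀ i j k, i ≠ k → u i j * u k j = 0
  row_sum : ∀ i, ∑ j, u i j = 1
  col_sum : ∀ j, ∑ i, u i j = 1

variable {A B : Type*} [CStarAlgebra A] [CStarAlgebra B]

theorem IsMagicUnitary.map {u : Matrix V V A} (hu : IsMagicUnitary u) (f : A →⋆ₐ[ℂ] B) :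
    IsMagicUnitary (u.map f) where
  isStarProjection i j := (hu.isStarProjection i j).map f
  row_orthogonal i j k h := by simp [← map_mul, hu.row_orthogonal i j k h]
  col_orthogonal i j k h := by simp [← map_mul, hu.col_orthogonal i j k h]
  row_sum i := by simp [← map_sum, hu.row_sum i]
  col_sum i := by simp [← map_sum, hu.col_sum i]

theorem IsMagicUnitary.mul {u v : Matrix V V A} (hu : IsMagicUnitary u) (hv : IsMagicUnitary v)
    (h : ∀ i j k l, Commute (u i j) (v k l)) : IsMagicUnitary (u * v) where
  isStarProjection i j := by
    classical
    constructor
    · rw [IsIdempotentElem, Matrix.mul_apply, Finset.sum_mul_sum]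
      refine Finset.sum_congr rfl fun k _ => ?_
      rw [Finset.sum_eq_single k]
      · rw [(h i k k j).symm.mul_mul_mul_comm, (hu.isStarProjection i k).isIdempotentElem,
          (hv.isStarProjection k j).isIdempotentElem]
      · intro l _ hl
        rw [(h i l k j).symm.mul_mul_mul_comm, hu.row_orthogonal i k l hl.symm, zero_mul]
      · simp
    · rw [Matrix.mul_apply, isSelfAdjoint_iff, star_sum]
      refine Finset.sum_congr rfl fun k _ => ?_
      rw [star_mul, (hu.isStarProjection i k).isSelfAdjoint.star_eq,
        (hv.isStarProjection k j).isSelfAdjoint.star_eq, (h i k k j).eq]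
  row_orthogonal i j k hjk := by
    rw [Matrix.mul_apply, Matrix.mul_apply, Finset.sum_mul_sum]
    refine Finset.sum_eq_zero fun a _ => Finset.sum_eq_zero fun b _ => ?_
    rw [(h i b a j).symm.mul_mul_mul_comm]
    rcases eq_or_ne a b with rfl | hab
    · rw [hv.row_orthogonal a j k hjk, mul_zero]
    · rw [hu.row_orthogonal i a b hab, zero_mul]
  col_orthogonal i j k hik := by
    rw [Matrix.mul_apply, Matrix.mul_apply, Finset.sum_mul_sum]
    refine Finset.sum_eq_zero fun a _ => Finset.sum_eq_zero fun b _ => ?_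
    rw [(h k b a j).symm.mul_mul_mul_comm]
    rcases eq_or_ne a b with rfl | hab
    · rw [hu.col_orthogonal i a k hik, zero_mul]
    · rw [hv.col_orthogonal a j b hab, mul_zero]
  row_sum i := by
    simp_rw [Matrix.mul_apply]
    rw [Finset.sum_comm]
    simp_rw [← Finset.mul_sum, hv.row_sum, mul_one, hu.row_sum]
  col_sum j := by
    simp_rw [Matrix.mul_apply]
    rw [Finset.sum_comm]
    simp_rw [← Finset.sum_mul, hu.col_sum, one_mul, hv.col_sum]

theorem IsMagicUnitary.op {u : Matrix V V A} (hu : IsMagicUnitary u) :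
    IsMagicUnitary (Matrix.of fun i j => MulOpposite.op (u j i)) where
  isStarProjection i j :=
    ⟨congrArg MulOpposite.op (hu.isStarProjection j i).isIdempotentElem.eq,
      congrArg MulOpposite.op (hu.isStarProjection j i).isSelfAdjoint.star_eq⟩
  row_orthogonal i j k h := congrArg MulOpposite.op (hu.col_orthogonal k i j h.symm)
  col_orthogonal i j k h := congrArg MulOpposite.op (hu.row_orthogonal j k i h.symm)
  row_sum i := by
    simp_rw [Matrix.of_apply]
    rw [← Finset.op_sum, hu.col_sum, MulOpposite.op_one]
  col_sum i := by
    simp_rw [Matrix.of_apply]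
    rw [← Finset.op_sum, hu.row_sum, MulOpposite.op_one]

theorem IsMagicUnitary.one [DecidableEq V] : IsMagicUnitary (1 : Matrix V V A) where
  isStarProjection i j := by
    rcases eq_or_ne i j with rfl | h
    · simp
    · simp [Matrix.one_apply_ne h]
  row_orthogonal i j k h := by
    rcases eq_or_ne i j with rfl | h'
    · simp [Matrix.one_apply_ne h]
    · simp [Matrix.one_apply_ne h']
  col_orthogonal i j k h := by
    rcases eq_or_ne i j with rfl | h'
    · simp [Matrix.one_apply_ne h.symm]
    · simp [Matrix.one_apply_ne h']
  row_sum i := by simp [Matrix.one_apply]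
  col_sum i := by simp [Matrix.one_apply]

variable (G : SimpleGraph V) [DecidableRel G.Adj]

/-- The matrix of generators of the free *-algebra on `V × V`. -/
def genMatrix (V : Type*) : Matrix V V (FreeStar (V × V)) :=
  Matrix.of fun i j => FreeStar.gen (i, j)

/-- The elements to be killed: they express that the (self-adjoint) generators form a magic unitary
which commutes with the adjacency matrix `d` of the graph. -/
inductive QAutRel : FreeStar (V × V) → Prop
  | idem (i j : V) : QAutRel (genMatrix V i j * genMatrix V i j - genMatrix V i j)
  | row_orthogonal (i j k : V) (h : j ≠ k) : QAutRel (genMatrix V i j * genMatrix V i k)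
  | col_orthogonal (i j k : V) (h : i ≠ k) : QAutRel (genMatrix V i j * genMatrix V k j)
  | row_sum (i : V) : QAutRel (∑ j, genMatrix V i j - 1)
  | col_sum (j : V) : QAutRel (∑ i, genMatrix V i j - 1)
  | comm (i j : V) : QAutRel
      ((G.adjMatrix (FreeStar (V × V)) * genMatrix V -
        genMatrix V * G.adjMatrix (FreeStar (V × V))) i j)

theorem boundedRel_qaut : BoundedRel {x | QAutRel G x} := by
  intro x
  have hp0 : ∀ (C : ℝ) (p : CStarSeminorm (FreeStar (V × V))) x, p x ≤ C → p x ≤ |C| :=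
    fun C p x h => h.trans (le_abs_self C)
  refine FreeStar.induction (P := fun x => ∃ C : ℝ, ∀ p : CStarSeminorm (FreeStar (V × V)),
    Admissible {x | QAutRel G x} p → p x ≤ C) ?_ ?_ ?_ ?_ ?_ x
  · exact ⟨1, fun p _ => p.map_one_le⟩
  · rintro ⟨i, j⟩
    refine ⟨1, fun p hp => ?_⟩
    have h1 := hp _ (QAutRel.idem i j)
    have h2 : p (genMatrix V i j) ^ 2 ≤ p (genMatrix V i j) := by
      rw [← p.map_star_mul_self]
      have h3 : star (genMatrix V i j) = genMatrix V i j := FreeStar.star_gen _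
      rw [h3]
      have h4 := map_add_le_add p (genMatrix V i j * genMatrix V i j - genMatrix V i j)
        (genMatrix V i j)
      rwa [sub_add_cancel, h1, zero_add] at h4
    change p (genMatrix V i j) ≤ 1
    nlinarith
  · rintro x y ⟨C, hC⟩ ⟨D, hD⟩
    exact ⟨C + D, fun p hp => (map_add_le_add p x y).trans (add_le_add (hC p hp) (hD p hp))⟩
  · rintro x y ⟨C, hC⟩ ⟨D, hD⟩
    exact ⟨|C| * |D|, fun p hp => (p.map_mul_le x y).trans
      (mul_le_mul (hp0 C p x (hC p hp)) (hp0 D p y (hD p hp)) (apply_nonneg _ _) (abs_nonneg _))⟩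
  · rintro c x ⟨C, hC⟩
    exact ⟨‖c‖ * C, fun p hp => by
      rw [map_smul_eq_mul]; exact mul_le_mul_of_nonneg_left (hC p hp) (norm_nonneg c)⟩

/-- The algebra `A(X)` of a finite graph: the universal C*-algebra generated by the entries of a
magic unitary matrix that commutes with the adjacency matrix. -/
def QAut : Type _ := UniversalCStar {x | QAutRel G x} (boundedRel_qaut G)

namespace QAut

instance : CStarAlgebra (QAut G) :=
  inferInstanceAs (CStarAlgebra (UniversalCStar _ (boundedRel_qaut G)))

/-- The canonical map from the free *-algebra. -/
def of : FreeStar (V × V) →⋆ₐ[ℂ] QAut G := UniversalCStar.of (boundedRel_qaut G)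

theorem of_rel {x : FreeStar (V × V)} (hx : QAutRel G x) : of G x = 0 :=
  UniversalCStar.of_rel (boundedRel_qaut G) hx

/-- The fundamental matrix of `A(X)`. -/
def u : Matrix V V (QAut G) := (genMatrix V).map (of G)

theorem u_apply (i j : V) : u G i j = of G (FreeStar.gen (i, j)) := rfl

theorem u_apply' (i j : V) : u G i j = of G (genMatrix V i j) := rfl

theorem isMagicUnitary_u : IsMagicUnitary (u G) where
  isStarProjection i j := by
    constructor
    · have := of_rel G (QAutRel.idem i j)
      rw [map_sub, map_mul, sub_eq_zero] at this
      exact this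
    · rw [isSelfAdjoint_iff, u_apply, ← StarHomClass.map_star, FreeStar.star_gen]
  row_orthogonal i j k h := by
    rw [u_apply', u_apply', ← map_mul]
    exact of_rel G (QAutRel.row_orthogonal i j k h)
  col_orthogonal i j k h := by
    rw [u_apply', u_apply', ← map_mul]
    exact of_rel G (QAutRel.col_orthogonal i j k h)
  row_sum i := by
    have := of_rel G (QAutRel.row_sum i)
    rwa [map_sub, map_sum, map_one, sub_eq_zero] at this
  col_sum i := by
    have := of_rel G (QAutRel.col_sum i)
    rwa [map_sub, map_sum, map_one, sub_eq_zero] at this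

theorem adjMatrix_mul_u : G.adjMatrix (QAut G) * u G = u G * G.adjMatrix (QAut G) := by
  have key : ∀ M N : Matrix V V (FreeStar (V × V)),
      (M * N).map (of G) = M.map (of G) * N.map (of G) :=
    fun M N => Matrix.map_mul (f := (of G : FreeStar (V × V) →+* QAut G))
  have hd : (G.adjMatrix (FreeStar (V × V))).map (of G) = G.adjMatrix (QAut G) :=
    adjMatrix_map G (of G : FreeStar (V × V) →+* QAut G)
  rw [u, ← hd, ← key, ← key]
  ext i j
  have := of_rel G (QAutRel.comm i j)
  rwa [Matrix.sub_apply, map_sub, sub_eq_zero] at this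

variable {G} {B : Type*} [CStarAlgebra B]

theorem hom_ext {φ ψ : QAut G →⋆ₐ[ℂ] B} (h : ∀ i j, φ (u G i j) = ψ (u G i j)) : φ = ψ := by
  refine UniversalCStar.hom_ext (boundedRel_qaut G) fun x => ?_
  have : φ.comp (of G) = ψ.comp (of G) := FreeStar.hom_ext fun s => h s.1 s.2
  exact DFunLike.congr_fun this x

/-- The universal property of `A(X)`: every magic unitary matrix over a C*-algebra that commutes
with the adjacency matrix is the image of the fundamental one. -/
def lift (w : Matrix V V B) (hw : IsMagicUnitary w)
    (hc : G.adjMatrix B * w = w * G.adjMatrix B) : QAut G →⋆ₐ[ℂ] B :=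
  UniversalCStar.lift (boundedRel_qaut G)
    (FreeStar.lift (fun s => w s.1 s.2) fun s => (hw.isStarProjection s.1 s.2).isSelfAdjoint) (by
      set φ : FreeStar (V × V) →⋆ₐ[ℂ] B := FreeStar.lift (fun s => w s.1 s.2)
        fun s => (hw.isStarProjection s.1 s.2).isSelfAdjoint
      have hφ : ∀ i j, φ (genMatrix V i j) = w i j := fun i j => FreeStar.lift_gen _ _ (i, j)
      rintro _ (⟨i, j⟩ | ⟨i, j, k, h⟩ | ⟨i, j, k, h⟩ | ⟨i⟩ | ⟨i⟩ | ⟨i, j⟩)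
      · rw [map_sub, map_mul, hφ, (hw.isStarProjection i j).isIdempotentElem.eq, sub_self]
      · rw [map_mul, hφ, hφ, hw.row_orthogonal i j k h]
      · rw [map_mul, hφ, hφ, hw.col_orthogonal i j k h]
      · simp_rw [map_sub, map_sum, hφ, hw.row_sum, map_one, sub_self]
      · simp_rw [map_sub, map_sum, hφ, hw.col_sum, map_one, sub_self]
      · have h1 : (genMatrix V).map φ = w := by ext i j; exact hφ i j
        have hd : (G.adjMatrix (FreeStar (V × V))).map φ = G.adjMatrix B :=
          adjMatrix_map G (φ : FreeStar (V × V) →+* B)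
        have key : ∀ M N : Matrix V V (FreeStar (V × V)),
            (M * N).map φ = M.map φ * N.map φ :=
          fun M N => Matrix.map_mul (f := (φ : FreeStar (V × V) →+* B))
        rw [Matrix.sub_apply, map_sub, sub_eq_zero, ← Matrix.map_apply (f := φ),
          ← Matrix.map_apply (f := φ), key, key, h1, hd, hc])

theorem lift_u (w : Matrix V V B) (hw : IsMagicUnitary w)
    (hc : G.adjMatrix B * w = w * G.adjMatrix B) (i j : V) : lift w hw hc (u G i j) = w i j :=
  (UniversalCStar.lift_of (boundedRel_qaut G) _ _ _).trans (FreeStar.lift_gen _ _ (i, j))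

theorem adjMatrix_mul_map (f : QAut G →⋆ₐ[ℂ] B) :
    G.adjMatrix B * (u G).map f = (u G).map f * G.adjMatrix B := by
  have key : ∀ M N : Matrix V V (QAut G), (M * N).map f = M.map f * N.map f :=
    fun M N => Matrix.map_mul (f := (f : QAut G →+* B))
  have hd : (G.adjMatrix (QAut G)).map f = G.adjMatrix B := adjMatrix_map G (f : QAut G →+* B)
  rw [← hd, ← key, ← key, adjMatrix_mul_u]

variable (G)

/-- The comultiplication `Δ (u i j) = ∑ k, u i k ⊗ u k j`. -/
def comul : QAut G →⋆ₐ[ℂ] MaxTensor (QAut G) (QAut G) :=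
  lift ((u G).map MaxTensor.inl * (u G).map MaxTensor.inr)
    (((isMagicUnitary_u G).map _).mul ((isMagicUnitary_u G).map _)
      fun _ _ _ _ => MaxTensor.commute_inl_inr _ _)
    (by rw [← Matrix.mul_assoc, adjMatrix_mul_map, Matrix.mul_assoc, adjMatrix_mul_map,
      Matrix.mul_assoc])

theorem comul_u (i j : V) :
    comul G (u G i j) = ∑ k, MaxTensor.tmul (u G i k) (u G k j) := by
  rw [comul, lift_u, Matrix.mul_apply]
  exact Finset.sum_congr rfl fun k _ => MaxTensor.inl_mul_inr _ _

/-- The counit `ε (u i j) = δ i j`. -/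
def counit [DecidableEq V] : QAut G →⋆ₐ[ℂ] ℂ :=
  lift 1 IsMagicUnitary.one (by rw [Matrix.mul_one, Matrix.one_mul])

theorem counit_u [DecidableEq V] (i j : V) : counit G (u G i j) = if i = j then 1 else 0 := by
  rw [counit, lift_u, Matrix.one_apply]

/-- The antipode `S (u i j) = u j i`, with values in the opposite algebra. -/
def antipode : QAut G →⋆ₐ[ℂ] (QAut G)ᵐᵒᵖ :=
  lift (Matrix.of fun i j => MulOpposite.op (u G j i)) (isMagicUnitary_u G).op (by
    ext i j
    have h := congrFun (congrFun (adjMatrix_mul_u G) j) i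
    apply MulOpposite.unop_injective
    simp only [SimpleGraph.adjMatrix_mul_apply, SimpleGraph.mul_adjMatrix_apply, Matrix.of_apply,
      Finset.unop_sum, MulOpposite.unop_op] at h ⊢
    exact h.symm)

theorem antipode_u (i j : V) : antipode G (u G i j) = MulOpposite.op (u G j i) := by
  rw [antipode, lift_u, Matrix.of_apply]

/-- The Hopf C*-algebra structure of `A(X)`. -/
def hopf [DecidableEq V] : HopfMaps (QAut G) where
  comul := comul G
  counit := counit G
  antipode := antipode G

end QAut

/-- The direct product of graphs: `(i, α) ∼ (j, β)` iff `i ∼ j` and `α ∼ β`. -/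
def directProd {W : Type*} (X : SimpleGraph V) (Y : SimpleGraph W) : SimpleGraph (V × W) where
  Adj x y := X.Adj x.1 y.1 ∧ Y.Adj x.2 y.2
  symm := ⟨fun _ _ h => ⟨h.1.symm, h.2.symm⟩⟩
  loopless := ⟨fun _ h => h.1.ne rfl⟩

instance {W : Type*} (X : SimpleGraph V) (Y : SimpleGraph W) [DecidableRel X.Adj]
    [DecidableRel Y.Adj] : DecidableRel (directProd X Y).Adj :=
  fun x y => inferInstanceAs (Decidable (X.Adj x.1 y.1 ∧ Y.Adj x.2 y.2))

instance {W : Type*} [DecidableEq V] [DecidableEq W] (X : SimpleGraph V) (Y : SimpleGraph W)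
    [DecidableRel X.Adj] [DecidableRel Y.Adj] : DecidableRel (X.boxProd Y).Adj :=
  fun x y => inferInstanceAs
    (Decidable (X.Adj x.1 y.1 ∧ x.2 = y.2 ∨ Y.Adj x.2 y.2 ∧ x.1 = y.1))

/-- `A(Z) = A(X) ⊗ A(Y)` for a graph `Z` on the product of the vertex sets: there is an isomorphism
of Hopf C*-algebras that sends the fundamental matrix of `A(Z)` to the tensor product of those of
`A(X)` and `A(Y)`. -/
def QAutEqTensor {W : Type*} [Fintype W] [DecidableEq V] [DecidableEq W]
    (X : SimpleGraph V) (Y : SimpleGraph W) (Z : SimpleGraph (V × W))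
    [DecidableRel X.Adj] [DecidableRel Y.Adj] [DecidableRel Z.Adj] : Prop :=
  ∃ Φ : QAut Z ≃⋆ₐ[ℂ] MaxTensor (QAut X) (QAut Y),
    (∀ i j α β, Φ (QAut.u Z (i, α) (j, β)) = MaxTensor.tmul (QAut.u X i j) (QAut.u Y α β)) ∧
    IsHopfHom (QAut.hopf Z) ((QAut.hopf X).tensor (QAut.hopf Y)) Φ.toStarAlgHom

end magic

end QuantumGraph

end

open scoped TensorProduct

noncomputable section

namespace QuantumGraph

open Matrix Polynomial
open scoped Kronecker

/-! ### Polynomials in adjacency matrices -/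

section scalarMatrices

variable {V W : Type*} [Fintype V] [DecidableEq V] [Fintype W] [DecidableEq W]

/-! Let u, v, U be the fundamental matrices of A(X), A(Y), A(Z), where Z is either product. Since
d_Z is d_X ⊗ d_Y or d_X ⊗ 1 + 1 ⊗ d_Y, the magic unitary u ⊗ v commutes with d_Z, and the universal
property gives a map A(Z) → A(X) ⊗ A(Y). No spectral condition enters here.

The inverse requires U to split. As U commutes with d_Z, it commutes with every polynomial in d_Z
(`commute_scalarMatrix_of_mem_adjoin`). In a common eigenbasis of d_X ⊗ 1 and 1 ⊗ d_Y the
eigenvalues of d_Z are the λμ, or the λ + μ, and the condition on ratios, or differences, says that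
this value determines λ and μ. By interpolation d_X ⊗ 1 and 1 ⊗ d_Y are polynomials in d_Z
(`mem_adjoin_kronecker`, `mem_adjoin_kroneckerSum`). For a connected regular graph the all-ones
matrix J is in turn a polynomial in the adjacency matrix (`ones_mem_adjoin_adjMatrix`). Hence U also
commutes with d_X ⊗ 1, 1 ⊗ d_Y, J ⊗ 1 and 1 ⊗ J.

Commutation with 1 ⊗ J says that P_ij = ∑_β U_(i,α),(j,β) is independent of α and equals the
corresponding sum down a column, so P is a magic unitary; it commutes with d_X. Likewise J ⊗ 1
yields Q_αβ = ∑_j U_(i,α),(j,β), commuting with d_Y. Expanding both along the row (i,α) of U,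
orthogonality leaves P_ij Q_αβ = Q_αβ P_ij = U_(i,α),(j,β)
(`fstMarginal_mul_fstMarginal_swapMatrix`). So P and Q define homomorphisms into A(Z) with commuting
ranges, that is, a homomorphism on the maximal tensor product. The two maps are inverse to each
other on generators, and the Hopf structures are compared on generators as well. -/

theorem exists_polynomial_eval_eq {ι : Type*} [Finite ι] (f g : ι → ℂ)
    (h : ∀ i j, f i = f j → g i = g j) : ∃ p : ℂ[X], ∀ i, p.eval (f i) = g i := by
  classical
  have := Fintype.ofFinite ι
  have hfac : g.FactorsThrough f := fun i j hij => h i j hij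
  -- The nodes are the distinct values of `f`. The extension of `g` is well defined on them by `h`,
  -- and its default value 0 off the range of `f` is never used.
  refine ⟨Lagrange.interpolate (Finset.univ.image f) id (Function.extend f g 0), fun i => ?_⟩
  have := Lagrange.eval_interpolate_at_node (s := Finset.univ.image f) (v := id) (i := f i)
    (Function.extend f g 0) Function.injective_id.injOn (Finset.mem_image_of_mem f (Finset.mem_univ i))
  rw [id, hfac.extend_apply] at this
  exact this

theorem map_diagonal_mem_adjoin {ι : Type*} [Fintype ι] [DecidableEq ι]
    (φ : Matrix ι ι ℂ →ₐ[ℂ] Matrix ι ι ℂ) (f g : ι → ℂ) (h : ∀ i j, f i = f j → g i = g j) :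
    φ (diagonal g) ∈ Algebra.adjoin ℂ {φ (diagonal f)} := by
  obtain ⟨p, hp⟩ := exists_polynomial_eval_eq f g h
  have h1 : φ (diagonal g) = aeval (φ (diagonal f)) p := by
    rw [aeval_algHom_apply]
    congr 1
    -- A polynomial in a diagonal matrix is computed entrywise, because `diagonal` is an algebra
    -- homomorphism from functions.
    change diagonalAlgHom ℂ g = aeval (diagonalAlgHom ℂ f) p
    rw [aeval_algHom_apply]
    congr 1
    funext i
    rw [← hp i]
    simp
  rw [h1]
  exact aeval_mem_adjoin_singleton ℂ _

/-- Conjugation by S ⊗ T, with S and T the eigenvector unitaries of `a` and `b`. That one φ serves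
both matrices is the point: questions about polynomials in a ⊗ b or a ⊗ 1 + 1 ⊗ b become questions
about functions on pairs of eigenvalues. -/
theorem exists_simultaneous_diagonalization {a : Matrix V V ℂ} {b : Matrix W W ℂ}
    (ha : a.IsHermitian) (hb : b.IsHermitian) :
    ∃ φ : Matrix (V × W) (V × W) ℂ →ₐ[ℂ] Matrix (V × W) (V × W) ℂ,
      φ (diagonal fun x => (ha.eigenvalues x.1 : ℂ)) = a ⊗ₖ (1 : Matrix W W ℂ) ∧
      φ (diagonal fun x => (hb.eigenvalues x.2 : ℂ)) = (1 : Matrix V V ℂ) ⊗ₖ b := by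
  let S : Matrix V V ℂ := ↑ha.eigenvectorUnitary
  let T : Matrix W W ℂ := ↑hb.eigenvectorUnitary
  have hS1 : S * star S = 1 := Unitary.coe_mul_star_self _
  have hT1 : T * star T = 1 := Unitary.coe_mul_star_self _
  have hST : S ⊗ₖ T ∈ unitary (Matrix (V × W) (V × W) ℂ) :=
    kronecker_mem_unitary ha.eigenvectorUnitary.2 hb.eigenvectorUnitary.2
  have key : ∀ (M : Matrix V V ℂ) (N : Matrix W W ℂ),
      Unitary.conjStarAlgAut ℂ _ ⟨S ⊗ₖ T, hST⟩ (M ⊗ₖ N) = (S * M * star S) ⊗ₖ (T * N * star T) := by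
    intro M N
    rw [Unitary.conjStarAlgAut_apply, mul_kronecker_mul, mul_kronecker_mul, star_eq_conjTranspose,
      star_eq_conjTranspose, star_eq_conjTranspose, conjTranspose_kronecker]
  have h1 := ha.spectral_theorem
  have h2 := hb.spectral_theorem
  rw [Unitary.conjStarAlgAut_apply] at h1 h2
  refine ⟨(Unitary.conjStarAlgAut ℂ _ ⟨S ⊗ₖ T, hST⟩).toAlgEquiv.toAlgHom, ?_, ?_⟩
  · have h3 : (diagonal fun x : V × W => (ha.eigenvalues x.1 : ℂ)) =
        diagonal (fun i => (ha.eigenvalues i : ℂ)) ⊗ₖ (1 : Matrix W W ℂ) := by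
      rw [← diagonal_one, diagonal_kronecker_diagonal]; simp
    rw [h3]
    refine (key _ _).trans ?_
    rw [mul_one, hT1]
    exact congrArg (· ⊗ₖ (1 : Matrix W W ℂ)) h1.symm
  · have h3 : (diagonal fun x : V × W => (hb.eigenvalues x.2 : ℂ)) =
        (1 : Matrix V V ℂ) ⊗ₖ diagonal (fun i => (hb.eigenvalues i : ℂ)) := by
      rw [← diagonal_one, diagonal_kronecker_diagonal]; simp
    rw [h3]
    refine (key _ _).trans ?_
    rw [mul_one, hS1]
    exact congrArg ((1 : Matrix V V ℂ) ⊗ₖ ·) h2.symm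

theorem eigenvalue_mem_spectrum {a : Matrix V V ℂ} (ha : a.IsHermitian) (i : V) :
    (ha.eigenvalues i : ℂ) ∈ spectrum ℂ a := by
  rw [ha.spectrum_eq_image_range]
  exact ⟨_, ⟨i, rfl⟩, rfl⟩

/-- If the products of eigenvalues determine the eigenvalues, then `a ⊗ 1` and `1 ⊗ b` are
polynomials in `a ⊗ b`. -/
theorem mem_adjoin_kronecker {a : Matrix V V ℂ} {b : Matrix W W ℂ}
    (ha : a.IsHermitian) (hb : b.IsHermitian)
    (ha0 : (0 : ℂ) ∉ spectrum ℂ a) (hb0 : (0 : ℂ) ∉ spectrum ℂ b)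
    (h : {r : ℂ | ∃ x ∈ spectrum ℂ a, ∃ y ∈ spectrum ℂ a, r = x / y} ∩
      {r : ℂ | ∃ x ∈ spectrum ℂ b, ∃ y ∈ spectrum ℂ b, r = x / y} = {1}) :
    a ⊗ₖ (1 : Matrix W W ℂ) ∈ Algebra.adjoin ℂ {a ⊗ₖ b} ∧
      (1 : Matrix V V ℂ) ⊗ₖ b ∈ Algebra.adjoin ℂ {a ⊗ₖ b} := by
  obtain ⟨φ, h1, h2⟩ := exists_simultaneous_diagonalization ha hb
  have h3 : a ⊗ₖ b = φ (diagonal fun x => (ha.eigenvalues x.1 : ℂ) * hb.eigenvalues x.2) := by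
    rw [← diagonal_mul_diagonal, map_mul, h1, h2, ← mul_kronecker_mul, mul_one, one_mul]
  have key : ∀ x y : V × W, (ha.eigenvalues x.1 : ℂ) * hb.eigenvalues x.2 =
      ha.eigenvalues y.1 * hb.eigenvalues y.2 →
      (ha.eigenvalues x.1 : ℂ) = ha.eigenvalues y.1 ∧
        (hb.eigenvalues x.2 : ℂ) = hb.eigenvalues y.2 := by
    intro x y hxy
    have ha1 : (ha.eigenvalues y.1 : ℂ) ≠ 0 :=
      fun h0 => ha0 (h0 ▸ eigenvalue_mem_spectrum ha y.1)
    have hb1 : (hb.eigenvalues x.2 : ℂ) ≠ 0 :=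
      fun h0 => hb0 (h0 ▸ eigenvalue_mem_spectrum hb x.2)
    -- Separating the variables in λμ = λ'μ' gives λ/λ' = μ'/μ, a number in both ratio sets, hence
    -- 1. The exclusion of the eigenvalue 0 is what permits the division.
    have h4 : (ha.eigenvalues x.1 : ℂ) / ha.eigenvalues y.1 =
        hb.eigenvalues y.2 / hb.eigenvalues x.2 := by
      rw [div_eq_div_iff ha1 hb1, hxy, mul_comm]
    have h5 : (ha.eigenvalues x.1 : ℂ) / ha.eigenvalues y.1 ∈ ({1} : Set ℂ) := by
      rw [← h]
      exact ⟨⟨_, eigenvalue_mem_spectrum ha _, _, eigenvalue_mem_spectrum ha _, rfl⟩,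
        ⟨_, eigenvalue_mem_spectrum hb _, _, eigenvalue_mem_spectrum hb _, h4⟩⟩
    have h6 : (ha.eigenvalues x.1 : ℂ) / ha.eigenvalues y.1 = 1 := h5
    exact ⟨(div_eq_one_iff_eq ha1).1 h6, ((div_eq_one_iff_eq hb1).1 (h4 ▸ h6)).symm⟩
  rw [h3, ← h1, ← h2]
  exact ⟨map_diagonal_mem_adjoin φ _ _ fun x y hxy => (key x y hxy).1,
    map_diagonal_mem_adjoin φ _ _ fun x y hxy => (key x y hxy).2⟩

/-- If the sums of eigenvalues determine the eigenvalues, then `a ⊗ 1` and `1 ⊗ b` are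
polynomials in `a ⊗ 1 + 1 ⊗ b`. -/
theorem mem_adjoin_kroneckerSum {a : Matrix V V ℂ} {b : Matrix W W ℂ}
    (ha : a.IsHermitian) (hb : b.IsHermitian)
    (h : {r : ℂ | ∃ x ∈ spectrum ℂ a, ∃ y ∈ spectrum ℂ a, r = x - y} ∩
      {r : ℂ | ∃ x ∈ spectrum ℂ b, ∃ y ∈ spectrum ℂ b, r = x - y} = {0}) :
    a ⊗ₖ (1 : Matrix W W ℂ) ∈ Algebra.adjoin ℂ {a ⊗ₖ 1 + 1 ⊗ₖ b} ∧
      (1 : Matrix V V ℂ) ⊗ₖ b ∈ Algebra.adjoin ℂ {a ⊗ₖ 1 + 1 ⊗ₖ b} := by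
  obtain ⟨φ, h1, h2⟩ := exists_simultaneous_diagonalization ha hb
  have h3 : a ⊗ₖ 1 + 1 ⊗ₖ b =
      φ (diagonal fun x => (ha.eigenvalues x.1 : ℂ) + hb.eigenvalues x.2) := by
    rw [← diagonal_add, map_add, h1, h2]
  have key : ∀ x y : V × W, (ha.eigenvalues x.1 : ℂ) + hb.eigenvalues x.2 =
      ha.eigenvalues y.1 + hb.eigenvalues y.2 →
      (ha.eigenvalues x.1 : ℂ) = ha.eigenvalues y.1 ∧
        (hb.eigenvalues x.2 : ℂ) = hb.eigenvalues y.2 := by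
    intro x y hxy
    -- Additive form of the same separation: the common value lies in both difference sets, hence is
    -- 0.
    have h4 : (ha.eigenvalues x.1 : ℂ) - ha.eigenvalues y.1 =
        hb.eigenvalues y.2 - hb.eigenvalues x.2 := by
      linear_combination hxy
    have h5 : (ha.eigenvalues x.1 : ℂ) - ha.eigenvalues y.1 ∈ ({0} : Set ℂ) := by
      rw [← h]
      exact ⟨⟨_, eigenvalue_mem_spectrum ha _, _, eigenvalue_mem_spectrum ha _, rfl⟩,
        ⟨_, eigenvalue_mem_spectrum hb _, _, eigenvalue_mem_spectrum hb _, h4⟩⟩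
    have h6 : (ha.eigenvalues x.1 : ℂ) - ha.eigenvalues y.1 = 0 := h5
    exact ⟨sub_eq_zero.1 h6, (sub_eq_zero.1 (h4 ▸ h6)).symm⟩
  rw [h3, ← h1, ← h2]
  exact ⟨map_diagonal_mem_adjoin φ _ _ fun x y hxy => (key x y hxy).1,
    map_diagonal_mem_adjoin φ _ _ fun x y hxy => (key x y hxy).2⟩

/-- Hoffman's theorem: for a connected regular graph the all-ones matrix is a polynomial in the
adjacency matrix. -/
theorem exists_aeval_adjMatrix_eq_ones (G : SimpleGraph V) [DecidableRel G.Adj]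
    (hG : G.Connected) {k : ℕ} (hk : G.IsRegularOfDegree k) :
    ∃ q : ℝ[X], aeval (G.adjMatrix ℝ) q = Matrix.of fun _ _ => 1 := by
  set d := G.adjMatrix ℝ with hd
  obtain ⟨v₀⟩ := hG.nonempty
  have hint : IsIntegral ℝ d := Algebra.IsIntegral.isIntegral d
  -- By regularity the constant vector is an eigenvector for the degree `k`, so the minimal
  -- polynomial is (X - k) h. The matrix h(d) will be a nonzero multiple of the all-ones matrix.
  have hroot : (minpoly ℝ d).IsRoot (k : ℝ) := by
    rw [← Matrix.minpoly_toLin']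
    refine Module.End.isRoot_of_hasEigenvalue (Module.End.hasEigenvalue_of_hasEigenvector
      (x := fun _ => (1 : ℝ)) ⟨?_, fun h => one_ne_zero (congrFun h v₀)⟩)
    rw [Module.End.mem_eigenspace_iff]
    funext i
    have := SimpleGraph.adjMatrix_mulVec_const_apply_of_regular (a := (1 : ℝ)) hk (v := i)
    rw [mul_one] at this
    exact this.trans (mul_one _).symm
  obtain ⟨h, hh⟩ := dvd_iff_isRoot.2 hroot
  set H := aeval d h with hH
  -- For a regular graph k - d is the Laplacian, whose kernel consists of the constant vectors when
  -- the graph is connected.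
  have hlap : G.lapMatrix ℝ = -(d - algebraMap ℝ _ (k : ℝ)) := by
    rw [SimpleGraph.lapMatrix, neg_sub, hd, SimpleGraph.degMatrix]
    congr 1
    ext i j
    simp [hk.degree_eq, Matrix.algebraMap_matrix_apply, Matrix.diagonal_apply]
  have h0 : (d - algebraMap ℝ _ (k : ℝ)) * H = 0 := by
    have := minpoly.aeval ℝ d
    rwa [hh, map_mul, map_sub, aeval_X, aeval_C] at this
  have h0' : H * (d - algebraMap ℝ _ (k : ℝ)) = 0 := by
    have := minpoly.aeval ℝ d
    rwa [hh, mul_comm, map_mul, map_sub, aeval_X, aeval_C] at this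
  have hcol : ∀ M : Matrix V V ℝ, G.lapMatrix ℝ * M = 0 → ∀ i j l, M i l = M j l := by
    intro M hM i j l
    refine (SimpleGraph.lapMatrix_mulVec_eq_zero_iff_forall_reachable G (x := fun a => M a l)).1 ?_
      i j (hG.preconnected i j)
    funext a
    exact congrFun (congrFun hM a) l
  have hc1 := hcol H (by rw [hlap, neg_mul, h0, neg_zero])
  -- The Laplacian is symmetric, so transposing H (d - k) = 0 shows that the rows of `H` are
  -- constant too.
  have hc2 := hcol Hᵀ (by
    rw [← Matrix.transpose_inj, Matrix.transpose_mul, Matrix.transpose_transpose,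
      (SimpleGraph.isSymm_lapMatrix ℝ G).eq, hlap, mul_neg, h0', neg_zero, Matrix.transpose_zero])
  -- All entries of `H` are equal. If they were 0, then h would annihilate d with degree one less
  -- than that of the minimal polynomial.
  have hH0 : H v₀ v₀ ≠ 0 := by
    intro hz
    have hHz : H = 0 := by
      ext i j
      rw [hc1 i v₀ j, ← Matrix.transpose_apply H, hc2 j v₀ v₀, Matrix.transpose_apply, hz]; rfl
    have hne : h ≠ 0 := by
      rintro rfl
      exact minpoly.ne_zero hint (by rw [hh, mul_zero])
    have hdeg := minpoly.degree_le_of_ne_zero ℝ d hne hHz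
    rw [hh, degree_mul, degree_X_sub_C, degree_eq_natDegree hne] at hdeg
    norm_cast at hdeg
    omega
  refine ⟨C (H v₀ v₀)⁻¹ * h, ?_⟩
  ext i j
  have : H i j = H v₀ v₀ := by
    rw [hc1 i v₀ j, ← Matrix.transpose_apply H, hc2 j v₀ v₀, Matrix.transpose_apply]
  rw [map_mul, aeval_C, ← hH, ← Algebra.smul_def, Matrix.smul_apply, this, smul_eq_mul,
    inv_mul_cancel₀ hH0, Matrix.of_apply]

/-- The real polynomial of Hoffman's theorem, carried over to complex matrices by extension of
scalars. -/
theorem ones_mem_adjoin_adjMatrix (G : SimpleGraph V) [DecidableRel G.Adj]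
    (hG : G.Connected) (hk : ∃ k, G.IsRegularOfDegree k) :
    (Matrix.of fun _ _ => 1 : Matrix V V ℂ) ∈ Algebra.adjoin ℂ {G.adjMatrix ℂ} := by
  obtain ⟨k, hk⟩ := hk
  obtain ⟨q, hq⟩ := exists_aeval_adjMatrix_eq_ones G hG hk
  let ψ : Matrix V V ℝ →ₐ[ℝ] Matrix V V ℂ := Complex.ofRealAm.mapMatrix
  have h1 : ψ (G.adjMatrix ℝ) = G.adjMatrix ℂ := adjMatrix_map G Complex.ofRealHom
  have h2 : (Matrix.of fun _ _ => 1 : Matrix V V ℂ) =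
      aeval (G.adjMatrix ℂ) (q.map (algebraMap ℝ ℂ)) := by
    rw [aeval_map_algebraMap, ← h1, aeval_algHom_apply, hq]
    ext i j
    simp [ψ]
  rw [h2]
  exact aeval_mem_adjoin_singleton ℂ _

/-- `M ↦ M ⊗ 1`. -/
def kroneckerOne (V W : Type*) [Fintype V] [DecidableEq V] [Fintype W] [DecidableEq W] :
    Matrix V V ℂ →ₐ[ℂ] Matrix (V × W) (V × W) ℂ :=
  AlgHom.ofLinearMap
    { toFun := fun M => M ⊗ₖ (1 : Matrix W W ℂ)
      map_add' := fun M N => add_kronecker M N 1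
      map_smul' := fun c M => smul_kronecker c M 1 }
    one_kronecker_one fun M N => by
      change (M * N) ⊗ₖ (1 : Matrix W W ℂ) = (M ⊗ₖ 1) * (N ⊗ₖ 1)
      rw [← mul_kronecker_mul, mul_one]

theorem kroneckerOne_apply (M : Matrix V V ℂ) : kroneckerOne V W M = M ⊗ₖ 1 := rfl

/-- `N ↦ 1 ⊗ N`. -/
def oneKronecker (V W : Type*) [Fintype V] [DecidableEq V] [Fintype W] [DecidableEq W] :
    Matrix W W ℂ →ₐ[ℂ] Matrix (V × W) (V × W) ℂ :=
  AlgHom.ofLinearMap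
    { toFun := fun N => (1 : Matrix V V ℂ) ⊗ₖ N
      map_add' := fun M N => kronecker_add 1 M N
      map_smul' := fun c M => kronecker_smul c 1 M }
    one_kronecker_one fun M N => by
      change (1 : Matrix V V ℂ) ⊗ₖ (M * N) = (1 ⊗ₖ M) * (1 ⊗ₖ N)
      rw [← mul_kronecker_mul, mul_one]

theorem oneKronecker_apply (N : Matrix W W ℂ) : oneKronecker V W N = 1 ⊗ₖ N := rfl

/-- An algebra homomorphism carries polynomials in `a` to polynomials in its image. This is used
with `b` the all-ones matrix and `a` an adjacency matrix. -/
theorem kroneckerOne_mem_adjoin {a b : Matrix V V ℂ} (h : b ∈ Algebra.adjoin ℂ {a}) :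
    b ⊗ₖ (1 : Matrix W W ℂ) ∈ Algebra.adjoin ℂ {a ⊗ₖ (1 : Matrix W W ℂ)} := by
  have h1 : kroneckerOne V W b ∈ (Algebra.adjoin ℂ {a}).map (kroneckerOne V W) := ⟨b, h, rfl⟩
  rwa [AlgHom.map_adjoin_singleton, kroneckerOne_apply, kroneckerOne_apply] at h1

theorem oneKronecker_mem_adjoin {a b : Matrix W W ℂ} (h : b ∈ Algebra.adjoin ℂ {a}) :
    (1 : Matrix V V ℂ) ⊗ₖ b ∈ Algebra.adjoin ℂ {(1 : Matrix V V ℂ) ⊗ₖ a} := by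
  have h1 : oneKronecker V W b ∈ (Algebra.adjoin ℂ {a}).map (oneKronecker V W) := ⟨b, h, rfl⟩
  rwa [AlgHom.map_adjoin_singleton, oneKronecker_apply, oneKronecker_apply] at h1

end scalarMatrices

/-! ### Adjacency matrices of the two graph products -/

section products

variable {V W : Type*} (X : SimpleGraph V) (Y : SimpleGraph W) [DecidableRel X.Adj]
  [DecidableRel Y.Adj]

theorem adjMatrix_directProd :
    (directProd X Y).adjMatrix ℂ = X.adjMatrix ℂ ⊗ₖ Y.adjMatrix ℂ := by
  ext ⟨i, α⟩ ⟨j, β⟩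
  have h : (directProd X Y).Adj (i, α) (j, β) ↔ X.Adj i j ∧ Y.Adj α β := Iff.rfl
  simp only [SimpleGraph.adjMatrix_apply, kronecker_apply, h]
  by_cases h1 : X.Adj i j <;> by_cases h2 : Y.Adj α β <;> simp [h1, h2]

/-- The disjunction becomes a sum because the graphs have no loops: the two alternatives never hold
together. -/
theorem adjMatrix_boxProd [DecidableEq V] [DecidableEq W] :
    (X.boxProd Y).adjMatrix ℂ = X.adjMatrix ℂ ⊗ₖ 1 + 1 ⊗ₖ Y.adjMatrix ℂ := by
  ext ⟨i, α⟩ ⟨j, β⟩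
  simp only [SimpleGraph.adjMatrix_apply, kronecker_apply, SimpleGraph.boxProd_adj,
    Matrix.add_apply, Matrix.one_apply]
  by_cases h1 : i = j <;> by_cases h2 : α = β <;> simp [h1, h2]

end products

/-! ### Scalar matrices commuting with a matrix over an algebra -/

section commutant

variable {V W A : Type*} [CStarAlgebra A]

/-- A complex matrix, regarded as a matrix over `A`. -/
def scalarMatrix (A : Type*) [CStarAlgebra A] (M : Matrix V V ℂ) : Matrix V V A :=
  M.map (algebraMap ℂ A)

theorem scalarMatrix_adjMatrix (G : SimpleGraph V) [DecidableRel G.Adj] :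
    scalarMatrix A (G.adjMatrix ℂ) = G.adjMatrix A := adjMatrix_map G (algebraMap ℂ A)

theorem scalarMatrix_add (M N : Matrix V V ℂ) :
    scalarMatrix A (M + N) = scalarMatrix A M + scalarMatrix A N :=
  Matrix.map_add _ (map_add (algebraMap ℂ A)) M N

variable [Fintype V] [Fintype W]

theorem scalarMatrix_mul_apply (M : Matrix V V ℂ) (u : Matrix V V A) (i j : V) :
    (scalarMatrix A M * u) i j = ∑ k, M i k • u k j := by
  simp [Matrix.mul_apply, scalarMatrix, Algebra.smul_def]

theorem mul_scalarMatrix_apply (M : Matrix V V ℂ) (u : Matrix V V A) (i j : V) :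
    (u * scalarMatrix A M) i j = ∑ k, M k j • u i k := by
  simp [Matrix.mul_apply, scalarMatrix, Algebra.smul_def, Algebra.commutes]

theorem commute_scalarMatrix_one [DecidableEq V] (u : Matrix V V A) :
    Commute (scalarMatrix A (1 : Matrix V V ℂ)) u := by
  rw [scalarMatrix, Matrix.map_one _ (map_zero _) (map_one _)]
  exact Commute.one_left u

/-- The scalar matrices commuting with `u` form a subalgebra, the preimage of a centralizer, so
commutation with `a` passes to all polynomials in `a`. -/
theorem commute_scalarMatrix_of_mem_adjoin [DecidableEq V] {a b : Matrix V V ℂ} {u : Matrix V V A}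
    (h : b ∈ Algebra.adjoin ℂ {a}) (ha : Commute (scalarMatrix A a) u) :
    Commute (scalarMatrix A b) u := by
  let ψ : Matrix V V ℂ →ₐ[ℂ] Matrix V V A := (Algebra.ofId ℂ A).mapMatrix
  have h1 : Algebra.adjoin ℂ {a} ≤ (Subalgebra.centralizer ℂ {u}).comap ψ := by
    refine Algebra.adjoin_le ?_
    rintro _ rfl
    exact Subalgebra.mem_centralizer_iff ℂ |>.2 fun g hg => hg ▸ ha.eq.symm
  exact (Subalgebra.mem_centralizer_iff ℂ |>.1 (h1 h) u rfl).symm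

/-- The tensor product of two matrices over an algebra. -/
def prodMatrix (u : Matrix V V A) (v : Matrix W W A) : Matrix (V × W) (V × W) A :=
  Matrix.of fun x y => u x.1 y.1 * v x.2 y.2

/-- Each entry factors as an entry of Mu times an entry of Nv. Entries of `u` stay to the left of
those of `v`, so `u` and `v` need not commute with each other. -/
theorem commute_scalarMatrix_kronecker {M : Matrix V V ℂ} {N : Matrix W W ℂ} {u : Matrix V V A}
    {v : Matrix W W A} (hM : Commute (scalarMatrix A M) u) (hN : Commute (scalarMatrix A N) v) :
    Commute (scalarMatrix A (M ⊗ₖ N)) (prodMatrix u v) := by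
  ext ⟨i, α⟩ ⟨j, β⟩
  have h1 := congrFun (congrFun hM.eq i) j
  have h2 := congrFun (congrFun hN.eq α) β
  rw [scalarMatrix_mul_apply, mul_scalarMatrix_apply] at h1 h2 ⊢
  have h3 : ∀ (c d : ℂ) (x y : A), (c * d) • (x * y) = (c • x) * (d • y) := fun c d x y =>
    (smul_mul_smul_comm c x d y).symm
  simp only [prodMatrix, kronecker_apply, Matrix.of_apply, Fintype.sum_prod_type, h3]
  rw [← Finset.sum_mul_sum, ← Finset.sum_mul_sum, h1, h2]

theorem IsMagicUnitary.prodMatrix {u : Matrix V V A} {v : Matrix W W A} (hu : IsMagicUnitary u)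
    (hv : IsMagicUnitary v) (h : ∀ i j α β, Commute (u i j) (v α β)) :
    IsMagicUnitary (prodMatrix u v) where
  isStarProjection x y := (hu.isStarProjection _ _).mul (hv.isStarProjection _ _) (h _ _ _ _)
  row_orthogonal x y z hyz := by
    simp only [QuantumGraph.prodMatrix, Matrix.of_apply]
    rw [(h _ _ _ _).symm.mul_mul_mul_comm]
    -- Distinct pairs differ in at least one coordinate, and the factor for that coordinate vanishes
    -- by orthogonality.
    by_cases h1 : y.1 = z.1
    · rw [hv.row_orthogonal _ _ _ fun h2 => hyz (Prod.ext h1 h2), mul_zero]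
    · rw [hu.row_orthogonal _ _ _ h1, zero_mul]
  col_orthogonal x y z hxz := by
    simp only [QuantumGraph.prodMatrix, Matrix.of_apply]
    rw [(h _ _ _ _).symm.mul_mul_mul_comm]
    by_cases h1 : x.1 = z.1
    · rw [hv.col_orthogonal _ _ _ fun h2 => hxz (Prod.ext h1 h2), mul_zero]
    · rw [hu.col_orthogonal _ _ _ h1, zero_mul]
  row_sum x := by
    simp only [QuantumGraph.prodMatrix, Matrix.of_apply, Fintype.sum_prod_type]
    rw [← Finset.sum_mul_sum, hu.row_sum, hv.row_sum, one_mul]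
  col_sum x := by
    simp only [QuantumGraph.prodMatrix, Matrix.of_apply, Fintype.sum_prod_type]
    rw [← Finset.sum_mul_sum, hu.col_sum, hv.col_sum, one_mul]

theorem isStarProjection_sum {ι : Type*} (s : Finset ι) (p : ι → A)
    (hp : ∀ i, IsStarProjection (p i)) (h : ∀ i j, i ≠ j → p i * p j = 0) :
    IsStarProjection (∑ i ∈ s, p i) := by
  constructor
  · rw [IsIdempotentElem, Finset.sum_mul_sum]
    refine Finset.sum_congr rfl fun i hi => ?_
    rw [Finset.sum_eq_single_of_mem i hi fun j _ hj => h i j hj.symm]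
    exact (hp i).isIdempotentElem
  · rw [isSelfAdjoint_iff, star_sum]
    exact Finset.sum_congr rfl fun i _ => (hp i).isSelfAdjoint.star_eq

end commutant

/-! ### Splitting a magic unitary on a product -/

section splitting

variable {V W : Type*} [Fintype V] [Fintype W]
  {A : Type*} [CStarAlgebra A] {U : Matrix (V × W) (V × W) A}

/-- Sum over the second column index, at the row index `α` of the second factor. -/
def fstMarginal (U : Matrix (V × W) (V × W) A) (α : W) : Matrix V V A :=
  Matrix.of fun i j => ∑ β, U (i, α) (j, β)

/-- Interchange of the two factors. -/
def swapMatrix (U : Matrix (V × W) (V × W) A) : Matrix (W × V) (W × V) A :=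
  Matrix.of fun x y => U x.swap y.swap

/-- Compare the entries of (1 ⊗ J) U = U (1 ⊗ J). The left side does not involve `α` and the right
side does not involve `β`, so both are independent of the two. Every use of 1 ⊗ J goes through this
identity. -/
theorem sum_row_eq_sum_col [DecidableEq V]
    (hJ : Commute (scalarMatrix A ((1 : Matrix V V ℂ) ⊗ₖ (Matrix.of fun _ _ => 1 : Matrix W W ℂ))) U)
    (i j : V) (α β : W) : ∑ γ, U (i, γ) (j, β) = ∑ γ, U (i, α) (j, γ) := by
  have h := congrFun (congrFun hJ.eq (i, α)) (j, β)
  rw [scalarMatrix_mul_apply, mul_scalarMatrix_apply] at h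
  simpa [Fintype.sum_prod_type, kronecker_apply, Matrix.one_apply, ite_smul,
    Finset.sum_comm (s := (Finset.univ : Finset V))] using h

theorem isMagicUnitary_fstMarginal [DecidableEq V] (hU : IsMagicUnitary U)
    (hJ : Commute (scalarMatrix A ((1 : Matrix V V ℂ) ⊗ₖ (Matrix.of fun _ _ => 1 : Matrix W W ℂ))) U)
    (α : W) : IsMagicUnitary (fstMarginal U α) where
  isStarProjection i j := isStarProjection_sum _ _ (fun β => hU.isStarProjection _ _)
    fun β γ h => hU.row_orthogonal _ _ _ fun h' => h (congrArg Prod.snd h')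
  row_orthogonal i j k h := by
    simp only [fstMarginal, Matrix.of_apply, Finset.sum_mul_sum]
    exact Finset.sum_eq_zero fun β _ => Finset.sum_eq_zero fun γ _ =>
      hU.row_orthogonal _ _ _ fun h' => h (congrArg Prod.fst h')
  col_orthogonal i j k h := by
    simp only [fstMarginal, Matrix.of_apply]
    -- As row sums, the two marginals lie in different rows of `U`. Rewritten as sums down the
    -- single column (j, α), they fall under column orthogonality.
    rw [← sum_row_eq_sum_col hJ i j α α, ← sum_row_eq_sum_col hJ k j α α, Finset.sum_mul_sum]
    exact Finset.sum_eq_zero fun β _ => Finset.sum_eq_zero fun γ _ =>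
      hU.col_orthogonal _ _ _ fun h' => h (congrArg Prod.fst h')
  row_sum i := by
    simp only [fstMarginal, Matrix.of_apply]
    rw [← hU.row_sum (i, α), Fintype.sum_prod_type]
  col_sum j := by
    simp only [fstMarginal, Matrix.of_apply]
    simp_rw [← sum_row_eq_sum_col hJ _ j α α]
    rw [← hU.col_sum (j, α), Fintype.sum_prod_type]

/-- The factor 1 in M ⊗ 1 keeps `α` and `β` fixed, so the relation holds separately for each `β` and
may be summed over `β`. -/
theorem commute_fstMarginal [DecidableEq W] {M : Matrix V V ℂ}
    (hM : Commute (scalarMatrix A (M ⊗ₖ (1 : Matrix W W ℂ))) U) (α : W) :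
    Commute (scalarMatrix A M) (fstMarginal U α) := by
  ext i j
  rw [scalarMatrix_mul_apply, mul_scalarMatrix_apply]
  have h : ∀ β, ∑ k, M i k • U (k, α) (j, β) = ∑ k, M k j • U (i, α) (k, β) := by
    intro β
    have h := congrFun (congrFun hM.eq (i, α)) (j, β)
    rw [scalarMatrix_mul_apply, mul_scalarMatrix_apply] at h
    simpa [Fintype.sum_prod_type, kronecker_apply, Matrix.one_apply] using h
  simp only [fstMarginal, Matrix.of_apply, Finset.smul_sum]
  rw [Finset.sum_comm, Finset.sum_congr rfl fun β _ => h β, Finset.sum_comm]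

theorem isMagicUnitary_swapMatrix (hU : IsMagicUnitary U) : IsMagicUnitary (swapMatrix U) where
  isStarProjection x y := hU.isStarProjection _ _
  row_orthogonal x y z h := hU.row_orthogonal _ _ _ (Prod.swap_injective.ne h)
  col_orthogonal x y z h := hU.col_orthogonal _ _ _ (Prod.swap_injective.ne h)
  row_sum x := by
    rw [← hU.row_sum x.swap]
    exact (Equiv.prodComm W V).sum_comp fun y => U x.swap y
  col_sum x := by
    rw [← hU.col_sum x.swap]
    exact (Equiv.prodComm W V).sum_comp fun y => U y x.swap

/-- Lets the statements about the first marginal be applied to the second factor. -/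
theorem commute_swapMatrix {M : Matrix V V ℂ} {N : Matrix W W ℂ}
    (h : Commute (scalarMatrix A (M ⊗ₖ N)) U) :
    Commute (scalarMatrix A (N ⊗ₖ M)) (swapMatrix U) := by
  ext x y
  have h1 := congrFun (congrFun h.eq x.swap) y.swap
  rw [scalarMatrix_mul_apply, mul_scalarMatrix_apply, ← (Equiv.prodComm W V).sum_comp,
    ← (Equiv.prodComm W V).sum_comp] at h1
  rw [scalarMatrix_mul_apply, mul_scalarMatrix_apply]
  simpa [kronecker_apply, swapMatrix, mul_comm] using h1

/-- Marginals do not depend on their base points `α'` and `i'`, so both can be taken along the row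
(i, α) of `U`. In the product of two sums over one row only the common term, at (j, β), survives, in
either order. -/
theorem fstMarginal_mul_fstMarginal_swapMatrix [DecidableEq V] [DecidableEq W]
    (hU : IsMagicUnitary U)
    (hJ : Commute (scalarMatrix A ((1 : Matrix V V ℂ) ⊗ₖ (Matrix.of fun _ _ => 1 : Matrix W W ℂ))) U)
    (hJ' : Commute
      (scalarMatrix A ((Matrix.of fun _ _ => 1 : Matrix V V ℂ) ⊗ₖ (1 : Matrix W W ℂ))) U)
    (α' : W) (i' : V) (i j : V) (α β : W) :
    fstMarginal U α' i j * fstMarginal (swapMatrix U) i' α β = U (i, α) (j, β) ∧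
      fstMarginal (swapMatrix U) i' α β * fstMarginal U α' i j = U (i, α) (j, β) := by
  have h1 : fstMarginal U α' i j = ∑ γ, U (i, α) (j, γ) :=
    (sum_row_eq_sum_col hJ i j α' α).symm.trans (sum_row_eq_sum_col hJ i j α α)
  have h2 : fstMarginal (swapMatrix U) i' α β = ∑ k, U (i, α) (k, β) :=
    (sum_row_eq_sum_col (commute_swapMatrix hJ') α β i' i).symm.trans
      (sum_row_eq_sum_col (commute_swapMatrix hJ') α β i i)
  have h3 := (hU.isStarProjection (i, α) (j, β)).isIdempotentElem.eq
  rw [h1, h2, Finset.sum_mul_sum, Finset.sum_mul_sum]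
  constructor
  · rw [Finset.sum_eq_single β, Finset.sum_eq_single j, h3]
    · exact fun k _ hk => hU.row_orthogonal _ _ _ fun h => hk (congrArg Prod.fst h).symm
    · simp
    · exact fun γ _ hγ => Finset.sum_eq_zero fun k _ =>
        hU.row_orthogonal _ _ _ fun h => hγ (congrArg Prod.snd h)
    · simp
  · rw [Finset.sum_eq_single j, Finset.sum_eq_single β, h3]
    · exact fun γ _ hγ => hU.row_orthogonal _ _ _ fun h => hγ (congrArg Prod.snd h).symm
    · simp
    · exact fun k _ hk => Finset.sum_eq_zero fun γ _ =>
        hU.row_orthogonal _ _ _ fun h => hk (congrArg Prod.fst h)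
    · simp

end splitting

/-! ### The isomorphism -/

section isomorphism

variable {V W : Type*} [Fintype V] [Fintype W]

/-- The commutant of `c` is a closed subalgebra. Stability under the involution is not needed, since
the generators are self-adjoint. -/
theorem QAut.commute_of_commute_u {G : SimpleGraph V} [DecidableRel G.Adj] {A : Type*}
    [CStarAlgebra A] (f : QAut G →⋆ₐ[ℂ] A) (c : A) (h : ∀ i j, Commute (f (QAut.u G i j)) c)
    (x : QAut G) : Commute (f x) c := by
  have hf : Continuous f := AddMonoidHomClass.continuous_of_bound f 1
    (fun x => by simpa using NonUnitalStarAlgHom.norm_apply_le f x)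
  refine (UniversalCStar.denseRange_of (boundedRel_qaut G)).induction_on
    (p := fun x => Commute (f x) c) x ?_ ?_
  · exact isClosed_eq (by fun_prop) (by fun_prop)
  · intro x
    refine FreeStar.induction (P := fun x => Commute (f (QAut.of G x)) c) ?_ ?_ ?_ ?_ ?_ x
    · rw [map_one, map_one]; exact Commute.one_left c
    · exact fun s => h s.1 s.2
    · intro x y hx hy; rw [map_add, map_add]; exact hx.add_left hy
    · intro x y hx hy; rw [map_mul, map_mul]; exact hx.mul_left hy
    · intro z x hx; rw [map_smul, map_smul]; exact hx.smul_left z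

variable (X : SimpleGraph V) (Y : SimpleGraph W) (Z : SimpleGraph (V × W))
  [DecidableRel X.Adj] [DecidableRel Y.Adj] [DecidableRel Z.Adj]

theorem commute_scalarMatrix_u :
    Commute (scalarMatrix (QAut X) (X.adjMatrix ℂ)) (QAut.u X) := by
  rw [scalarMatrix_adjMatrix]; exact QAut.adjMatrix_mul_u X

theorem commute_scalarMatrix_u_map {A : Type*} [CStarAlgebra A] (f : QAut X →⋆ₐ[ℂ] A) :
    Commute (scalarMatrix A (X.adjMatrix ℂ)) ((QAut.u X).map f) := by
  rw [scalarMatrix_adjMatrix]; exact QAut.adjMatrix_mul_map f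

/-- The tensor product of the fundamental matrices. -/
def tensorMatrix : Matrix (V × W) (V × W) (MaxTensor (QAut X) (QAut Y)) :=
  prodMatrix ((QAut.u X).map MaxTensor.inl) ((QAut.u Y).map MaxTensor.inr)

theorem tensorMatrix_apply (i j : V) (α β : W) :
    tensorMatrix X Y (i, α) (j, β) = MaxTensor.tmul (QAut.u X i j) (QAut.u Y α β) :=
  MaxTensor.inl_mul_inr _ _

theorem isMagicUnitary_tensorMatrix : IsMagicUnitary (tensorMatrix X Y) :=
  ((QAut.isMagicUnitary_u X).map _).prodMatrix ((QAut.isMagicUnitary_u Y).map _)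
    fun _ _ _ _ => MaxTensor.commute_inl_inr _ _

/-- Builds the inverse map: the two marginals of the fundamental matrix of A(Z) represent A(X) and
A(Y) in A(Z) with commuting ranges. -/
theorem exists_hom_of_marginals [DecidableEq V] [DecidableEq W] [Nonempty V] [Nonempty W]
    (hX : Commute (scalarMatrix (QAut Z) (X.adjMatrix ℂ ⊗ₖ (1 : Matrix W W ℂ))) (QAut.u Z))
    (hY : Commute (scalarMatrix (QAut Z) ((1 : Matrix V V ℂ) ⊗ₖ Y.adjMatrix ℂ)) (QAut.u Z))
    (hJX : Commute (scalarMatrix (QAut Z)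
      ((Matrix.of fun _ _ => 1 : Matrix V V ℂ) ⊗ₖ (1 : Matrix W W ℂ))) (QAut.u Z))
    (hJY : Commute (scalarMatrix (QAut Z)
      ((1 : Matrix V V ℂ) ⊗ₖ (Matrix.of fun _ _ => 1 : Matrix W W ℂ))) (QAut.u Z)) :
    ∃ Ψ : MaxTensor (QAut X) (QAut Y) →⋆ₐ[ℂ] QAut Z,
      (∀ i j α β, Ψ (MaxTensor.tmul (QAut.u X i j) (QAut.u Y α β)) = QAut.u Z (i, α) (j, β)) := by
  obtain ⟨i₀⟩ := ‹Nonempty V›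
  obtain ⟨α₀⟩ := ‹Nonempty W›
  have hU := QAut.isMagicUnitary_u Z
  have hcX := commute_fstMarginal hX α₀
  have hcY := commute_fstMarginal (commute_swapMatrix hY) i₀
  rw [scalarMatrix_adjMatrix] at hcX hcY
  let f : QAut X →⋆ₐ[ℂ] QAut Z := QAut.lift _ (isMagicUnitary_fstMarginal hU hJY α₀) hcX.eq
  let g : QAut Y →⋆ₐ[ℂ] QAut Z := QAut.lift _
    (isMagicUnitary_fstMarginal (isMagicUnitary_swapMatrix hU) (commute_swapMatrix hJX) i₀) hcY.eq
  have hf : ∀ i j, f (QAut.u X i j) = fstMarginal (QAut.u Z) α₀ i j := QAut.lift_u _ _ _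
  have hg : ∀ α β, g (QAut.u Y α β) = fstMarginal (swapMatrix (QAut.u Z)) i₀ α β :=
    QAut.lift_u _ _ _
  have hfg := fstMarginal_mul_fstMarginal_swapMatrix hU hJY hJX α₀ i₀
  have hcomm : ∀ a b, Commute (f a) (g b) := by
    -- Commutation spreads from generators in two passes, one in each variable.
    refine fun a b => QAut.commute_of_commute_u f _ (fun i j => ?_) a
    refine (QAut.commute_of_commute_u g _ (fun α β => ?_) b).symm
    rw [hf, hg]
    exact (hfg i j α β).2.trans (hfg i j α β).1.symm
  refine ⟨MaxTensor.lift f g hcomm, fun i j α β => ?_⟩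
  rw [MaxTensor.lift_tmul, hf, hg, (hfg i j α β).1]

/-- Both sides of each identity are *-homomorphisms on A(Z), so the generators suffice; bijectivity
of `Φ` plays no role. -/
theorem isHopfHom_of_map_u [DecidableEq V] [DecidableEq W]
    (Φ : QAut Z →⋆ₐ[ℂ] MaxTensor (QAut X) (QAut Y))
    (hΦ : ∀ i j α β,
      Φ (QAut.u Z (i, α) (j, β)) = MaxTensor.tmul (QAut.u X i j) (QAut.u Y α β)) :
    IsHopfHom (QAut.hopf Z) ((QAut.hopf X).tensor (QAut.hopf Y)) Φ where
  map_comul a := by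
    refine DFunLike.congr_fun (f := ((QAut.hopf X).tensor (QAut.hopf Y)).comul.comp Φ)
      (g := (MaxTensor.map Φ Φ).comp (QAut.hopf Z).comul) (QAut.hom_ext ?_) a
    rintro ⟨i, α⟩ ⟨j, β⟩
    change middleSwap _ _ (MaxTensor.map (QAut.comul X) (QAut.comul Y) (Φ (QAut.u Z _ _))) =
      MaxTensor.map Φ Φ (QAut.comul Z (QAut.u Z _ _))
    -- The tensor of the two comultiplications is split into a product of its legs, which expands
    -- into a double sum over (k, γ), the index set of the comultiplication of A(Z).
    rw [hΦ, MaxTensor.map_tmul, QAut.comul_u, QAut.comul_u, QAut.comul_u, map_sum,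
      Fintype.sum_prod_type, ← MaxTensor.inl_mul_inr, map_sum, map_sum, Finset.sum_mul_sum, map_sum]
    refine Finset.sum_congr rfl fun k _ => ?_
    rw [map_sum]
    refine Finset.sum_congr rfl fun γ _ => ?_
    rw [MaxTensor.inl_mul_inr, middleSwap_tmul, MaxTensor.map_tmul, hΦ, hΦ]
  map_counit a := by
    refine DFunLike.congr_fun (f := ((QAut.hopf X).tensor (QAut.hopf Y)).counit.comp Φ)
      (g := (QAut.hopf Z).counit) (QAut.hom_ext ?_) a
    rintro ⟨i, α⟩ ⟨j, β⟩
    rw [StarAlgHom.comp_apply, hΦ]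
    refine (MaxTensor.lift_tmul _ _ _ _ _).trans ?_
    change QAut.counit X _ * QAut.counit Y _ = QAut.counit Z _
    rw [QAut.counit_u, QAut.counit_u, QAut.counit_u]
    by_cases h1 : i = j <;> by_cases h2 : α = β <;> simp [h1, h2]
  map_antipode a := by
    refine DFunLike.congr_fun (f := ((QAut.hopf X).tensor (QAut.hopf Y)).antipode.comp Φ)
      (g := (opHom Φ).comp (QAut.hopf Z).antipode) (QAut.hom_ext ?_) a
    rintro ⟨i, α⟩ ⟨j, β⟩
    rw [StarAlgHom.comp_apply, hΦ]
    refine (MaxTensor.lift_tmul _ _ _ _ _).trans ?_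
    change opHom MaxTensor.inl (QAut.antipode X _) * opHom MaxTensor.inr (QAut.antipode Y _) =
      opHom Φ (QAut.antipode Z _)
    -- The product is taken in the opposite algebra, hence reversed; the legs commute, so the order
    -- is restored.
    rw [QAut.antipode_u,
      QAut.antipode_u, QAut.antipode_u, opHom_apply, opHom_apply, opHom_apply, MulOpposite.unop_op,
      MulOpposite.unop_op, MulOpposite.unop_op, hΦ, ← MulOpposite.op_mul,
      ← MaxTensor.inl_mul_inr, (MaxTensor.commute_inl_inr _ _).eq]

/-- If the adjacency matrices of the factors are polynomials in that of `Z`, and the latter commutes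
with tensor products, then `A(Z) = A(X) ⊗ A(Y)`. -/
theorem qautEqTensor_of_mem_adjoin [DecidableEq V] [DecidableEq W]
    (hX : X.Connected) (hY : Y.Connected)
    (hXreg : ∃ k, X.IsRegularOfDegree k) (hYreg : ∃ l, Y.IsRegularOfDegree l)
    (hZX : X.adjMatrix ℂ ⊗ₖ (1 : Matrix W W ℂ) ∈ Algebra.adjoin ℂ {Z.adjMatrix ℂ})
    (hZY : (1 : Matrix V V ℂ) ⊗ₖ Y.adjMatrix ℂ ∈ Algebra.adjoin ℂ {Z.adjMatrix ℂ})
    (hZ : Commute (scalarMatrix (MaxTensor (QAut X) (QAut Y)) (Z.adjMatrix ℂ))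
      (tensorMatrix X Y)) : QAutEqTensor X Y Z := by
  have := hX.nonempty
  have := hY.nonempty
  have hcX := commute_scalarMatrix_of_mem_adjoin hZX (commute_scalarMatrix_u Z)
  have hcY := commute_scalarMatrix_of_mem_adjoin hZY (commute_scalarMatrix_u Z)
  obtain ⟨Ψ, hΨ⟩ := exists_hom_of_marginals X Y Z hcX hcY
    (commute_scalarMatrix_of_mem_adjoin
      (kroneckerOne_mem_adjoin (ones_mem_adjoin_adjMatrix X hX hXreg)) hcX)
    (commute_scalarMatrix_of_mem_adjoin
      (oneKronecker_mem_adjoin (ones_mem_adjoin_adjMatrix Y hY hYreg)) hcY)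
  rw [scalarMatrix_adjMatrix] at hZ
  let Φ : QAut Z →⋆ₐ[ℂ] MaxTensor (QAut X) (QAut Y) :=
    QAut.lift _ (isMagicUnitary_tensorMatrix X Y) hZ.eq
  have hΦ : ∀ i j α β,
      Φ (QAut.u Z (i, α) (j, β)) = MaxTensor.tmul (QAut.u X i j) (QAut.u Y α β) :=
    fun i j α β => (QAut.lift_u _ _ _ _ _).trans (tensorMatrix_apply X Y i j α β)
  have h1 : Ψ.comp Φ = StarAlgHom.id ℂ _ := QAut.hom_ext fun ⟨i, α⟩ ⟨j, β⟩ => by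
    rw [StarAlgHom.comp_apply, hΦ, hΨ, StarAlgHom.coe_id, id_eq]
  have h3 : ∀ i j α β, Φ (Ψ (MaxTensor.tmul (QAut.u X i j) (QAut.u Y α β))) =
      MaxTensor.tmul (QAut.u X i j) (QAut.u Y α β) := fun i j α β => by rw [hΨ, hΦ]
  have h2 : Φ.comp Ψ = StarAlgHom.id ℂ _ := by
    obtain ⟨i₀⟩ := ‹Nonempty V›
    obtain ⟨α₀⟩ := ‹Nonempty W›
    refine MaxTensor.hom_ext (fun a => ?_) fun b => ?_
    · refine DFunLike.congr_fun (f := (Φ.comp Ψ).comp MaxTensor.inl)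
        (g := (StarAlgHom.id ℂ _).comp MaxTensor.inl) (QAut.hom_ext fun i j => ?_) a
      -- The row of `α₀` in the fundamental matrix of A(Y) sums to 1, so u_ij ⊗ 1 is a sum of
      -- elementary tensors of generators, on which `h3` applies.
      have h4 : (MaxTensor.inl (QAut.u X i j) : MaxTensor (QAut X) (QAut Y)) =
          ∑ β, MaxTensor.tmul (QAut.u X i j) (QAut.u Y α₀ β) := by
        simp_rw [← MaxTensor.inl_mul_inr]
        rw [← Finset.mul_sum, ← map_sum, (QAut.isMagicUnitary_u Y).row_sum, map_one, mul_one]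
      simp only [StarAlgHom.comp_apply, StarAlgHom.coe_id, id_eq, h4, map_sum, h3]
    · refine DFunLike.congr_fun (f := (Φ.comp Ψ).comp MaxTensor.inr)
        (g := (StarAlgHom.id ℂ _).comp MaxTensor.inr) (QAut.hom_ext fun α β => ?_) b
      have h4 : (MaxTensor.inr (QAut.u Y α β) : MaxTensor (QAut X) (QAut Y)) =
          ∑ j, MaxTensor.tmul (QAut.u X i₀ j) (QAut.u Y α β) := by
        simp_rw [← MaxTensor.inl_mul_inr]
        rw [← Finset.sum_mul, ← map_sum, (QAut.isMagicUnitary_u X).row_sum, map_one, one_mul]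
      simp only [StarAlgHom.comp_apply, StarAlgHom.coe_id, id_eq, h4, map_sum, h3]
  exact ⟨StarAlgEquiv.ofStarAlgHom Φ Ψ h1 h2, hΦ, isHopfHom_of_map_u X Y Z Φ hΦ⟩

end isomorphism

end QuantumGraph

/-! ### The direct and Cartesian products -/

open QuantumGraph

theorem theorem4p1 {V W : Type*} [Fintype V] [DecidableEq V] [Fintype W] [DecidableEq W]
    (X : SimpleGraph V) (Y : SimpleGraph W) [DecidableRel X.Adj] [DecidableRel Y.Adj]
    (hX : X.Connected) (hY : Y.Connected) (hXreg : ∃ k, X.IsRegularOfDegree k)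
    (hYreg : ∃ l, Y.IsRegularOfDegree l) :
    ((0 : ℂ) ∉ spectrum ℂ (X.adjMatrix ℂ) → (0 : ℂ) ∉ spectrum ℂ (Y.adjMatrix ℂ) →
      {r : ℂ | ∃ a ∈ spectrum ℂ (X.adjMatrix ℂ), ∃ b ∈ spectrum ℂ (X.adjMatrix ℂ), r = a / b} ∩
        {r : ℂ | ∃ a ∈ spectrum ℂ (Y.adjMatrix ℂ), ∃ b ∈ spectrum ℂ (Y.adjMatrix ℂ), r = a / b}
          = {1} →
      QuantumGraph.QAutEqTensor X Y (QuantumGraph.directProd X Y)) ∧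
    ({r : ℂ | ∃ a ∈ spectrum ℂ (X.adjMatrix ℂ), ∃ b ∈ spectrum ℂ (X.adjMatrix ℂ), r = a - b} ∩
        {r : ℂ | ∃ a ∈ spectrum ℂ (Y.adjMatrix ℂ), ∃ b ∈ spectrum ℂ (Y.adjMatrix ℂ), r = a - b}
          = {0} →
      QuantumGraph.QAutEqTensor X Y (X.boxProd Y)) := by
  have hcX := commute_scalarMatrix_u_map X
    (MaxTensor.inl : QAut X →⋆ₐ[ℂ] MaxTensor (QAut X) (QAut Y))
  have hcY := commute_scalarMatrix_u_map Y
    (MaxTensor.inr : QAut Y →⋆ₐ[ℂ] MaxTensor (QAut X) (QAut Y))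
  refine ⟨fun hX0 hY0 h => ?_, fun h => ?_⟩
  · have hmem := mem_adjoin_kronecker (X.isHermitian_adjMatrix ℂ) (Y.isHermitian_adjMatrix ℂ)
      hX0 hY0 h
    rw [← adjMatrix_directProd] at hmem
    refine qautEqTensor_of_mem_adjoin X Y _ hX hY hXreg hYreg hmem.1 hmem.2 ?_
    rw [adjMatrix_directProd]
    exact commute_scalarMatrix_kronecker hcX hcY
  · have hmem := mem_adjoin_kroneckerSum (X.isHermitian_adjMatrix ℂ) (Y.isHermitian_adjMatrix ℂ) h
    rw [← adjMatrix_boxProd] at hmem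
    refine qautEqTensor_of_mem_adjoin X Y _ hX hY hXreg hYreg hmem.1 hmem.2 ?_
    rw [adjMatrix_boxProd, scalarMatrix_add]
    exact (commute_scalarMatrix_kronecker hcX (commute_scalarMatrix_one _)).add_left
      (commute_scalarMatrix_kronecker (commute_scalarMatrix_one _) hcY)

end
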